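/- Fix an odd prime $p$. A *$\sigma$-pro-$p$-group* is a pro-$p$-group $G$ with a continuous action of a group $\{1,\sigma\}$ of order $2$; put $G^-=\{a\in G:{}^\sigma a=a^{-1}\}$, and let $D_i(G)$ denote the $i$-th dimension subgroup (the Zassenhaus filtration) of $G$. The *Haar measure on $G^-$* is the Borel probability measure for which all fibres of the map $G^-\to(G/N)^-$ have the same measure, for every $\sigma$-invariant open normal subgroup $N$ of $G$. For $n\ge 0$ let $F_n$ be the free pro-$p$-group on $x_1,\dots,x_n$, with the action of $\sigma$ given by ${}^\sigma x_i=x_i^{-1}$. For $r=(r_1,\dots,r_n)\in(F_n^-)^n$ let $N_r$ be the closed normal subgroup of $F_n$ generated by all conjugates of $r_1,\dots,r_n$, and put $G_r=F_n/N_r$. Let $\mathrm{Sch}$ be the set of $\sigma$-isomorphism classes of all groups $G_r$, for all $n\ge0$ and all $r\in(F_n^-)^n$, with the topology whose basis consists of the sets $U_{i,G}=\{[H]\in\mathrm{Sch}: H/D_i(H)\cong G/D_i(G)\ \sigma\text{-equivariantly}\}$ for $i\ge2$ and $[G]\in\mathrm{Sch}$. Let $\mathrm{Sch}_n\subset\mathrm{Sch}$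 be the subset of the classes $[G]$ for which the minimal number of topological generators of $G$ is equal to $n$. Let $\mu_n$ be the pushforward to the Borel $\sigma$-algebra of $\mathrm{Sch}$, under the map $r\mapsto[G_r]$, of the product on $(F_n^-)^n$ of the Haar measures on the factors $F_n^-$. Then there is a unique Borel probability measure $\mu_\infty$ on $\mathrm{Sch}$ such that $\mu_n(A)\to\mu_\infty(A)$ for $n\to\infty$ for every Borel set $A\subset\mathrm{Sch}$. For every $n\ge0$ it satisfies $$\mu_\infty(\mathrm{Sch}_n)\ =\ \frac{C_\infty}{C_n^2}\cdot p^{-n^2},$$ where $C_k=\prod_{i=1}^k(1-p^{-i})$ for every integer $k\ge0$ and for $k=\infty$. -/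

import Mathlib

open MeasureTheory Filter Topology

/-! ### `σ`-pro-`p`-groups -/

/-- A `σ`-pro-`p`-group: a compact Hausdorff topological group in which the open normal subgroups
with `p`-group quotient form a basis of neighbourhoods of `1` (a pro-`p`-group), together with
a continuous action of the group `{1, σ}` of order two, that is, a continuous endomorphism `σ`
with `σ ∘ σ = id`. -/
structure SigmaProP (p : ℕ) where
  carrier : Type
  [group : Group carrier]
  [top : TopologicalSpace carrier]
  [topGroup : IsTopologicalGroup carrier]
  [compact : CompactSpace carrier]
  [t2 : T2Space carrier]
  basis : ∀ U ∈ 𝓝 (1 : carrier), ∃ N : OpenNormalSubgroup carrier,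
    (N : Set carrier) ⊆ U ∧ IsPGroup p (carrier ⧸ N.toSubgroup)
  σ : carrier →ₜ* carrier
  σ_σ : ∀ x, σ (σ x) = x

namespace SigmaProP

attribute [instance] SigmaProP.group SigmaProP.top SigmaProP.topGroup SigmaProP.compact
  SigmaProP.t2

/-- Two `σ`-pro-`p`-groups are `σ`-isomorphic: there is an isomorphism of topological groups
that commutes with `σ`. -/
def Iso {p : ℕ} (G H : SigmaProP p) : Prop :=
  ∃ e : G.carrier ≃ₜ* H.carrier, ∀ x, e (G.σ x) = H.σ (e x)

theorem Iso.refl {p : ℕ} (G : SigmaProP p) : G.Iso G :=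
  ⟨ContinuousMulEquiv.refl _, fun _ => rfl⟩

theorem Iso.symm {p : ℕ} {G H : SigmaProP p} (h : G.Iso H) : H.Iso G := by
  obtain ⟨e, he⟩ := h
  refine ⟨e.symm, fun x => ?_⟩
  apply e.injective
  rw [he]
  simp

theorem Iso.trans {p : ℕ} {G H K : SigmaProP p} (h : G.Iso H) (h' : H.Iso K) : G.Iso K := by
  obtain ⟨e, he⟩ := h
  obtain ⟨f, hf⟩ := h'
  refine ⟨e.trans f, fun x => ?_⟩
  simp [he, hf]

/-- The set `G⁻` of odd elements: those with `σ a = a⁻¹`, with the topology induced from `G`. -/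
def Odd {p : ℕ} (G : SigmaProP p) : Type :=
  {a : G.carrier // G.σ a = a⁻¹}

/-- The quotient of a `σ`-pro-`p`-group by a closed `σ`-invariant normal subgroup. -/
def quot {p : ℕ} (G : SigmaProP p) (K : Subgroup G.carrier) (hn : K.Normal)
    (hc : IsClosed (K : Set G.carrier)) (hσ : ∀ x ∈ K, G.σ x ∈ K) : SigmaProP p :=
  haveI : IsClosed (K : Set G.carrier) := hc
  { carrier := G.carrier ⧸ K
    basis := by
      intro U hU
      have h1 : (QuotientGroup.mk : G.carrier → G.carrier ⧸ K) ⁻¹' U ∈ 𝓝 (1 : G.carrier) :=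
        (QuotientGroup.continuous_mk (N := K)).continuousAt.preimage_mem_nhds
          (by rw [QuotientGroup.mk_one]; exact hU)
      obtain ⟨N, hNU, hN⟩ := G.basis _ h1
      have hnorm : (N.toSubgroup.map (QuotientGroup.mk' K)).Normal :=
        Subgroup.Normal.map inferInstance _ (QuotientGroup.mk'_surjective K)
      refine ⟨{ toSubgroup := N.toSubgroup.map (QuotientGroup.mk' K)
                isOpen' := QuotientGroup.isOpenMap_coe _ N.isOpen'
                isNormal' := hnorm }, ?_, ?_⟩
      · rintro _ ⟨x, hx, rfl⟩
        exact hNU hx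
      · intro q
        induction q using QuotientGroup.induction_on with
        | H q =>
          induction q using QuotientGroup.induction_on with
          | H x =>
            obtain ⟨k, hk⟩ := hN (x : G.carrier ⧸ N.toSubgroup)
            refine ⟨k, ?_⟩
            rw [← QuotientGroup.mk_pow, QuotientGroup.eq_one_iff] at hk
            rw [← QuotientGroup.mk_pow, ← QuotientGroup.mk_pow, QuotientGroup.eq_one_iff]
            exact ⟨_, hk, rfl⟩
    σ :=
      { toMonoidHom := QuotientGroup.map K K G.σ.toMonoidHom hσ
        continuous_toFun := by
          refine continuous_quot_lift _ ?_
          exact continuous_quot_mk.comp G.σ.continuous_toFun }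
    σ_σ := by
      intro q
      induction q using QuotientGroup.induction_on with
      | H x => exact congrArg (QuotientGroup.mk : G.carrier → G.carrier ⧸ K) (G.σ_σ x) }

/-- The minimal number of (topological) generators of `G`. -/
noncomputable def numGens {p : ℕ} (G : SigmaProP p) : ℕ :=
  sInf {k | ∃ s : Fin k → G.carrier,
    (Subgroup.closure (Set.range s)).topologicalClosure = ⊤}

end SigmaProP

/-! ### The Zassenhaus filtration -/

/-- The dimension subgroups of a topological group (in the category of closed subgroups):
`D₁(G) = G`, and for `n ≥ 2` the closed subgroup `Dₙ(G)` is generated by the `p`-th powers of the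
elements of `D_{⌈n/p⌉}(G)` and by the commutator subgroups `[Dᵢ(G), Dⱼ(G)]` for `i + j = n`,
`i, j ≥ 1`. (By convention also `D₀(G) = G`.) -/
def zassenhaus (p : ℕ) [hp : Fact p.Prime] (G : Type) [Group G] [TopologicalSpace G]
    [IsTopologicalGroup G] : ℕ → Subgroup G
  | 0 => ⊤
  | 1 => ⊤
  | n + 2 =>
    (Subgroup.closure ((fun x => x ^ p) '' (zassenhaus p G ((n + 2) ⌈/⌉ p) : Set G)) ⊔
      ⨆ i : Fin (n + 1),
        ⁅zassenhaus p G (i.1 + 1), zassenhaus p G (n + 1 - i.1)⁆).topologicalClosure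
  termination_by n => n
  decreasing_by
    · rw [Nat.ceilDiv_eq_add_pred_div]
      have := hp.out.two_le
      rw [Nat.div_lt_iff_lt_mul (by omega)]
      nlinarith [Nat.sub_le (n + 2 + p) 1, Nat.sub_add_cancel (show 1 ≤ n + 2 + p by omega)]
    · omega
    · omega

theorem zassenhaus_isClosed (p : ℕ) [Fact p.Prime] (G : Type) [Group G] [TopologicalSpace G]
    [IsTopologicalGroup G] (n : ℕ) : IsClosed (zassenhaus p G n : Set G) := by
  match n with
  | 0 => rw [zassenhaus]; exact isClosed_univ
  | 1 => rw [zassenhaus]; exact isClosed_univ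
  | n + 2 => rw [zassenhaus]; exact Subgroup.isClosed_topologicalClosure _

theorem zassenhaus_map (p : ℕ) [hp : Fact p.Prime] (G : Type) [Group G] [TopologicalSpace G]
    [IsTopologicalGroup G] (f : G →* G) (hf : Continuous f) (n : ℕ) :
    (zassenhaus p G n).map f ≤ zassenhaus p G n := by
  induction n using Nat.strong_induction_on with
  | _ n ih =>
    match n with
    | 0 => rw [zassenhaus]; exact le_top
    | 1 => rw [zassenhaus]; exact le_top
    | n + 2 =>
      have hlt : (n + 2) ⌈/⌉ p < n + 2 := by
        rw [Nat.ceilDiv_eq_add_pred_div]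
        have := hp.out.two_le
        rw [Nat.div_lt_iff_lt_mul (by omega)]
        nlinarith [Nat.sub_le (n + 2 + p) 1, Nat.sub_add_cancel (show 1 ≤ n + 2 + p by omega)]
      have key : ∀ S : Subgroup G, S.map f ≤ S →
          S.topologicalClosure.map f ≤ S.topologicalClosure := by
        rintro S hS _ ⟨x, hx, rfl⟩
        exact map_mem_closure hf hx fun y hy => hS ⟨y, hy, rfl⟩
      rw [zassenhaus]
      apply key
      rw [Subgroup.map_sup, Subgroup.map_iSup]
      refine sup_le_sup ?_ (iSup_mono fun i => ?_)
      · rw [MonoidHom.map_closure]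
        apply Subgroup.closure_mono
        rintro _ ⟨_, ⟨x, hx, rfl⟩, rfl⟩
        exact ⟨f x, ih _ hlt ⟨x, hx, rfl⟩, by simp⟩
      · rw [Subgroup.map_commutator]
        exact Subgroup.commutator_mono (ih _ (by omega)) (ih _ (by omega))

theorem zassenhaus_normal (p : ℕ) [Fact p.Prime] (G : Type) [Group G] [TopologicalSpace G]
    [IsTopologicalGroup G] (n : ℕ) : (zassenhaus p G n).Normal :=
  ⟨fun x hx g => zassenhaus_map p G (MulAut.conj g).toMonoidHom
    (by
      change Continuous fun x => g * x * g⁻¹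
      fun_prop) n ⟨x, hx, rfl⟩⟩

/-- The quotient `G / Dᵢ(G)` with the induced action of `σ`. -/
def SigmaProP.modD {p : ℕ} [Fact p.Prime] (G : SigmaProP p) (i : ℕ) : SigmaProP p :=
  G.quot (zassenhaus p G.carrier i) (zassenhaus_normal p G.carrier i)
    (zassenhaus_isClosed p G.carrier i)
    fun x hx => zassenhaus_map p G.carrier G.σ.toMonoidHom G.σ.continuous_toFun i ⟨x, hx, rfl⟩

/-! ### The Haar measure on the set of odd elements -/

namespace SigmaProP

instance {p : ℕ} (G : SigmaProP p) : MeasurableSpace G.carrier := borel _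

instance {p : ℕ} (G : SigmaProP p) : BorelSpace G.carrier := ⟨rfl⟩

instance {p : ℕ} (G : SigmaProP p) : TopologicalSpace G.Odd := instTopologicalSpaceSubtype

instance {p : ℕ} (G : SigmaProP p) : MeasurableSpace G.Odd := borel _

instance {p : ℕ} (G : SigmaProP p) : BorelSpace G.Odd := ⟨rfl⟩

/-- The Haar measure of total mass one on `G`. -/
noncomputable def haar {p : ℕ} (G : SigmaProP p) : Measure G.carrier :=
  Measure.haarMeasure ⊤

/-- The map `G → G⁻`, `g ↦ g σ(g)⁻¹`. If `g = b a` with `a` even and `b` odd, its value is `b²`. -/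
def toOdd {p : ℕ} (G : SigmaProP p) (g : G.carrier) : G.Odd :=
  ⟨g * (G.σ g)⁻¹, by simp [G.σ_σ]⟩

theorem continuous_toOdd {p : ℕ} (G : SigmaProP p) : Continuous G.toOdd :=
  Continuous.subtype_mk (continuous_id.mul G.σ.continuous_toFun.inv) _

/-- The Haar measure on the set `G⁻` of odd elements. For odd `p`, it is the probability measure
for which all fibres of `G⁻ → (G/N)⁻` have the same measure, for every open normal `σ`-invariant
subgroup `N`; see `oddHaar_univ` and `oddHaar_fiber`. -/
noncomputable def oddHaar {p : ℕ} (G : SigmaProP p) : Measure G.Odd :=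
  G.haar.map G.toOdd

theorem haar_univ {p : ℕ} (G : SigmaProP p) : G.haar Set.univ = 1 :=
  Measure.haarMeasure_self (K₀ := (⊤ : TopologicalSpace.PositiveCompacts G.carrier))

theorem oddHaar_univ {p : ℕ} (G : SigmaProP p) : G.oddHaar Set.univ = 1 := by
  rw [oddHaar, Measure.map_apply G.continuous_toOdd.measurable MeasurableSet.univ,
    Set.preimage_univ, haar_univ]

theorem oddHaar_fiber {p : ℕ} [hp : Fact p.Prime] (hp2 : p ≠ 2) (G : SigmaProP p)
    (N : Subgroup G.carrier) (hn : N.Normal) (ho : IsOpen (N : Set G.carrier))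
    (hσ : ∀ x ∈ N, G.σ x ∈ N) (c : G.Odd) :
    G.oddHaar {b | c.1⁻¹ * b.1 ∈ N} =
      (Nat.card (G.quot N hn (N.isClosed_of_isOpen ho) hσ).Odd : ENNReal)⁻¹ := by
  set Q := G.quot N hn (N.isClosed_of_isOpen ho) hσ with hQ
  let π : G.carrier →* Q.carrier := QuotientGroup.mk' N
  have hπσ : ∀ x, π (G.σ x) = Q.σ (π x) := fun _ => rfl
  have hπs : Function.Surjective π := QuotientGroup.mk'_surjective N
  have hπN : ∀ x y, π x = π y ↔ x⁻¹ * y ∈ N := fun x y => QuotientGroup.eq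
  have hπc : Continuous π := QuotientGroup.continuous_mk
  have : DiscreteTopology Q.carrier := QuotientGroup.discreteTopology ho
  have : Finite Q.carrier := finite_of_compact_of_discrete
  have : Finite Q.Odd := Subtype.finite
  let _ : Fintype Q.Odd := Fintype.ofFinite _
  have : G.haar.IsMulLeftInvariant := Measure.isMulLeftInvariant_haarMeasure _
  let A : Q.Odd → Set G.carrier := fun q => {g | π (G.toOdd g).1 = q.1}
  have hAm : ∀ q, MeasurableSet (A q) := fun q =>
    ((isClosed_discrete ({q.1} : Set Q.carrier)).preimage
      (hπc.comp (continuous_subtype_val.comp G.continuous_toOdd))).measurableSet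
  have hone : Q.σ 1 = (1 : Q.carrier)⁻¹ := by simp
  have hAne : ∀ q, ∃ g, g ∈ A q := by
    rintro ⟨q, hq⟩
    obtain ⟨M, hM, hMp⟩ := Q.basis {1} (by simp)
    have hk : ∃ k, q ^ p ^ k = 1 := by
      obtain ⟨k, hk⟩ := hMp (q : Q.carrier ⧸ M.toSubgroup)
      refine ⟨k, ?_⟩
      rw [← QuotientGroup.mk_pow, QuotientGroup.eq_one_iff] at hk
      exact hM hk
    obtain ⟨k, hk⟩ := hk
    obtain ⟨l, hl⟩ : _root_.Odd (p ^ k) := (hp.out.odd_of_ne_two hp2).pow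
    obtain ⟨g, hg⟩ := hπs (q ^ (l + 1))
    refine ⟨g, ?_⟩
    change π (g * (G.σ g)⁻¹) = q
    rw [map_mul, map_inv, hπσ, hg, map_pow, hq, inv_pow, inv_inv, ← pow_add]
    rw [show l + 1 + (l + 1) = (2 * l + 1) + 1 by ring, ← hl, pow_succ, hk, one_mul]
  have hAtr : ∀ q, G.haar (A q) = G.haar (A ⟨1, hone⟩) := by
    intro q
    obtain ⟨g₀, hg₀⟩ := hAne q
    have : A ⟨1, hone⟩ = (fun h => g₀ * h) ⁻¹' A q := by
      ext h
      change π (h * (G.σ h)⁻¹) = 1 ↔ π (g₀ * h * (G.σ (g₀ * h))⁻¹) = q.1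
      have h1 : π (g₀ * (G.σ g₀)⁻¹) = q.1 := hg₀
      rw [← h1]
      have h2 : π (g₀ * h * (G.σ (g₀ * h))⁻¹) =
          π g₀ * π (h * (G.σ h)⁻¹) * (π (G.σ g₀))⁻¹ := by
        simp only [map_mul, map_inv, mul_inv_rev, mul_assoc]
      rw [h2, map_mul π g₀, map_inv]
      simp
    rw [this, measure_preimage_mul]
  have hsum : ∑ q, G.haar (A q) = 1 := by
    rw [← tsum_fintype (L := .unconditional _), ← measure_iUnion _ hAm, ← G.haar_univ]
    · congr 1
      refine Set.eq_univ_of_forall fun g => Set.mem_iUnion.2 ?_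
      refine ⟨⟨π (G.toOdd g).1, ?_⟩, rfl⟩
      rw [← hπσ, (G.toOdd g).2, map_inv]
    · intro q q' hqq'
      refine Set.disjoint_left.2 fun g hg hg' => hqq' (Subtype.ext ?_)
      exact (show π (G.toOdd g).1 = q.1 from hg).symm.trans hg'
  have hall : ∀ q, G.haar (A q) = (Nat.card Q.Odd : ENNReal)⁻¹ := by
    intro q
    rw [Finset.sum_congr rfl fun q' _ => (hAtr q').trans (hAtr q).symm] at hsum
    rw [Finset.sum_const, Finset.card_univ, nsmul_eq_mul, mul_comm] at hsum
    rw [Nat.card_eq_fintype_card]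
    exact ENNReal.eq_inv_of_mul_eq_one_left hsum
  have hset : {b : G.Odd | c.1⁻¹ * b.1 ∈ N} = {b : G.Odd | π b.1 = π c.1} := by
    ext b
    exact (hπN c.1 b.1).symm.trans eq_comm
  rw [hset, oddHaar, Measure.map_apply G.continuous_toOdd.measurable]
  · exact hall ⟨π c.1, by rw [← hπσ, c.2, map_inv]⟩
  · have hv : Continuous fun b : G.Odd => π b.1 := hπc.comp continuous_subtype_val
    exact ((isClosed_discrete ({π c.1} : Set Q.carrier)).preimage hv).measurableSet

end SigmaProP

/-! ### The free pro-`p`-group with odd generators -/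

/-- The normal subgroups of `p`-power index of the free group on `n` letters. -/
def PIndex (p n : ℕ) : Type :=
  {N : Subgroup (FreeGroup (Fin n)) // N.Normal ∧ ∃ k, N.index = p ^ k}

instance (p n : ℕ) (N : PIndex p n) : N.1.Normal := N.2.1

/-- The finite `p`-group `Φ / N`, where `Φ` is the free group on `n` letters, with the discrete
topology. -/
def Level (p n : ℕ) (N : PIndex p n) : Type := FreeGroup (Fin n) ⧸ N.1

instance (p n : ℕ) (N : PIndex p n) : Group (Level p n N) :=
  inferInstanceAs (Group (FreeGroup (Fin n) ⧸ N.1))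

instance (p n : ℕ) (N : PIndex p n) : TopologicalSpace (Level p n N) := ⊥

instance (p n : ℕ) (N : PIndex p n) : DiscreteTopology (Level p n N) := ⟨rfl⟩

theorem level_finite (p n : ℕ) [hp : Fact p.Prime] (N : PIndex p n) : Finite (Level p n N) := by
  obtain ⟨k, hk⟩ := N.2.2
  have : N.1.FiniteIndex := ⟨by rw [hk]; exact pow_ne_zero _ hp.out.ne_zero⟩
  exact inferInstanceAs (Finite (FreeGroup (Fin n) ⧸ N.1))

/-- The projection `Φ / N → Φ / M` for `N ≤ M`. -/
def levelMap (p n : ℕ) {N M : PIndex p n} (h : N.1 ≤ M.1) : Level p n N →* Level p n M :=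
  QuotientGroup.map N.1 M.1 (MonoidHom.id _) h

/-- The free pro-`p`-group on `n` generators, as the inverse limit of all finite `p`-group
quotients of the free group on `n` letters. -/
def freeProP (p n : ℕ) : Subgroup (∀ N : PIndex p n, Level p n N) where
  carrier := {f | ∀ (N M : PIndex p n) (h : N.1 ≤ M.1), levelMap p n h (f N) = f M}
  mul_mem' := by
    intro f g hf hg N M h
    simp [hf N M h, hg N M h]
  one_mem' := by
    intro N M h
    simp
  inv_mem' := by
    intro f hf N M h
    simp [hf N M h]

theorem freeProP_isClosed (p n : ℕ) :
    IsClosed (freeProP p n : Set (∀ N : PIndex p n, Level p n N)) := by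
  have : (freeProP p n : Set (∀ N : PIndex p n, Level p n N)) =
      ⋂ (N : PIndex p n) (M : PIndex p n) (h : N.1 ≤ M.1),
        {f | levelMap p n h (f N) = f M} := by
    ext f
    simp [freeProP]
  rw [this]
  refine isClosed_iInter fun N => isClosed_iInter fun M => isClosed_iInter fun h => ?_
  exact isClosed_eq (continuous_of_discreteTopology.comp (continuous_apply N))
    (continuous_apply M)

/-- The automorphism `xᵢ ↦ xᵢ⁻¹` of the free group. -/
def freeFlip (n : ℕ) : FreeGroup (Fin n) →* FreeGroup (Fin n) :=
  FreeGroup.lift fun i => (FreeGroup.of i)⁻¹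

theorem freeFlip_freeFlip (n : ℕ) (x : FreeGroup (Fin n)) : freeFlip n (freeFlip n x) = x := by
  have : (freeFlip n).comp (freeFlip n) = MonoidHom.id _ := by
    ext i
    simp [freeFlip]
  exact DFunLike.congr_fun this x

/-- The inverse image of `N` under `xᵢ ↦ xᵢ⁻¹`. -/
def PIndex.flip {p n : ℕ} (N : PIndex p n) : PIndex p n :=
  ⟨N.1.comap (freeFlip n), inferInstance, by
    obtain ⟨k, hk⟩ := N.2.2
    exact ⟨k, by
      rw [← hk]
      exact Subgroup.index_comap_of_surjective _ fun x => ⟨freeFlip n x, freeFlip_freeFlip n x⟩⟩⟩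

/-- The isomorphism `Φ / flip N → Φ / N` induced by `xᵢ ↦ xᵢ⁻¹`. -/
def levelFlip (p n : ℕ) (N : PIndex p n) : Level p n N.flip →* Level p n N :=
  QuotientGroup.map N.flip.1 N.1 (freeFlip n) le_rfl

/-- The action of `σ` on the free pro-`p`-group, induced by `xᵢ ↦ xᵢ⁻¹`. -/
def freeSigma (p n : ℕ) : freeProP p n →ₜ* freeProP p n where
  toFun f := ⟨fun N => levelFlip p n N (f.1 N.flip), by
    intro N M h
    have h' : N.flip.1 ≤ M.flip.1 := Subgroup.comap_mono h
    change levelMap p n h (levelFlip p n N (f.1 N.flip)) = levelFlip p n M (f.1 M.flip)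
    rw [← f.2 N.flip M.flip h']
    obtain ⟨x, hx⟩ := QuotientGroup.mk_surjective (f.1 N.flip)
    rw [← hx]
    rfl⟩
  map_one' := by
    ext N
    simp
  map_mul' f g := by
    ext N
    simp
  continuous_toFun := by
    refine Continuous.subtype_mk (continuous_pi fun N => ?_) _
    exact continuous_of_discreteTopology.comp ((continuous_apply _).comp continuous_subtype_val)

theorem freeProP_basis (p n : ℕ) [Fact p.Prime] (U : Set (freeProP p n))
    (hU : U ∈ 𝓝 (1 : freeProP p n)) :
    ∃ N : OpenNormalSubgroup (freeProP p n),
      (N : Set (freeProP p n)) ⊆ U ∧ IsPGroup p (freeProP p n ⧸ N.toSubgroup) := by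
  have hpow : ∀ (N : PIndex p n) (y : Level p n N), ∃ k, y ^ p ^ k = 1 := by
    intro N y
    obtain ⟨k, hk⟩ := N.2.2
    refine ⟨k, ?_⟩
    rw [← hk]
    exact pow_card_eq_one' (G := FreeGroup (Fin n) ⧸ N.1)
  obtain ⟨V, hV, hVU⟩ := mem_nhds_subtype _ _ _ |>.1 hU
  rw [nhds_pi, Filter.mem_pi] at hV
  obtain ⟨I, hI, t, ht, htV⟩ := hV
  have hker : ∀ N : PIndex p n, ∃ W : Subgroup (freeProP p n), W.Normal ∧
      IsOpen (W : Set (freeProP p n)) ∧ ∀ f, f ∈ W ↔ f.1 N = 1 := by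
    intro N
    let φ : freeProP p n →* Level p n N := (Pi.evalMonoidHom _ N).comp (freeProP p n).subtype
    refine ⟨φ.ker, inferInstance, ?_, fun f => Iff.rfl⟩
    have hφ : Continuous φ := (continuous_apply N).comp continuous_subtype_val
    exact (isOpen_discrete ({1} : Set (Level p n N))).preimage hφ
  choose W hWn hWo hW using hker
  have hset : ((⨅ N ∈ I, W N : Subgroup (freeProP p n)) : Set (freeProP p n)) =
      ⋂ N ∈ I, (W N : Set (freeProP p n)) := by
    simp
  have hopen : IsOpen ((⨅ N ∈ I, W N : Subgroup (freeProP p n)) : Set (freeProP p n)) := by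
    rw [hset]
    exact hI.isOpen_biInter fun N _ => hWo N
  have hnorm : (⨅ N ∈ I, W N : Subgroup (freeProP p n)).Normal :=
    Subgroup.normal_iInf_normal fun N => Subgroup.normal_iInf_normal fun _ => hWn N
  refine ⟨{ toSubgroup := ⨅ N ∈ I, W N
            isOpen' := hopen
            isNormal' := hnorm }, ?_, ?_⟩
  · intro f hf
    have hf' : f ∈ ⋂ N ∈ I, (W N : Set (freeProP p n)) := hset ▸ hf
    refine hVU (htV fun N hN => ?_)
    have h1 : f.1 N = 1 := (hW N f).1 (Set.mem_iInter₂.1 hf' N hN)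
    rw [h1]
    exact mem_of_mem_nhds (ht N)
  · intro q
    induction q using QuotientGroup.induction_on with
    | H f =>
      choose k hk using fun N : PIndex p n => hpow N (f.1 N)
      refine ⟨hI.toFinset.sup k, ?_⟩
      rw [← QuotientGroup.mk_pow, QuotientGroup.eq_one_iff]
      change f ^ p ^ (hI.toFinset.sup k) ∈ ⨅ N ∈ I, W N
      simp only [Subgroup.mem_iInf]
      intro N hN
      rw [hW]
      change f.1 N ^ p ^ (hI.toFinset.sup k) = 1
      obtain ⟨d, hd⟩ := Nat.exists_eq_add_of_le
        (Finset.le_sup (f := k) (hI.mem_toFinset.2 hN))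
      rw [hd, pow_add, pow_mul, hk, one_pow]

/-- The free pro-`p`-group `Fₙ` on `n` generators `x₁, …, xₙ`, with the action of `σ` for which
all `xᵢ` are odd. -/
def freeSigmaProP (p : ℕ) [Fact p.Prime] (n : ℕ) : SigmaProP p :=
  haveI : ∀ N : PIndex p n, Finite (Level p n N) := level_finite p n
  haveI : CompactSpace (freeProP p n) := isCompact_iff_compactSpace.1 (freeProP_isClosed p n).isCompact
  { carrier := freeProP p n
    basis := freeProP_basis p n
    σ := freeSigma p n
    σ_σ := by
      intro f
      ext N
      change levelFlip p n N (levelFlip p n N.flip (f.1 N.flip.flip)) = f.1 N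
      have h : N.flip.flip.1 ≤ N.1 := by
        intro x hx
        have : freeFlip n (freeFlip n x) ∈ N.1 := hx
        rwa [freeFlip_freeFlip] at this
      rw [← f.2 N.flip.flip N h]
      obtain ⟨x, hx⟩ := QuotientGroup.mk_surjective (f.1 N.flip.flip)
      rw [← hx]
      exact congrArg (QuotientGroup.mk : _ → FreeGroup (Fin n) ⧸ N.1) (freeFlip_freeFlip n x) }

/-! ### Weak Schur `σ`-groups -/

/-- The closed normal subgroup `N_r` of `Fₙ` generated by all conjugates of the odd elements
`r₁, …, rₙ`. -/
def relSubgroup (p : ℕ) [Fact p.Prime] {n : ℕ} (r : Fin n → (freeSigmaProP p n).Odd) :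
    Subgroup (freeSigmaProP p n).carrier :=
  (Subgroup.normalClosure (Set.range fun i => (r i).1)).topologicalClosure

theorem relSubgroup_normal (p : ℕ) [Fact p.Prime] {n : ℕ}
    (r : Fin n → (freeSigmaProP p n).Odd) : (relSubgroup p r).Normal :=
  Subgroup.is_normal_topologicalClosure _

theorem relSubgroup_sigma (p : ℕ) [Fact p.Prime] {n : ℕ}
    (r : Fin n → (freeSigmaProP p n).Odd) :
    ∀ x ∈ relSubgroup p r, (freeSigmaProP p n).σ x ∈ relSubgroup p r := by
  intro x hx
  refine map_mem_closure (freeSigmaProP p n).σ.continuous_toFun hx fun y hy => ?_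
  have hle : Subgroup.normalClosure (Set.range fun i => (r i).1) ≤
      (Subgroup.normalClosure (Set.range fun i => (r i).1)).comap
        (freeSigmaProP p n).σ.toMonoidHom := by
    refine Subgroup.normalClosure_le_normal ?_
    rintro _ ⟨i, rfl⟩
    refine Subgroup.mem_comap.2 ?_
    change (freeSigmaProP p n).σ (r i).1 ∈
      Subgroup.normalClosure (Set.range fun i => (r i).1)
    rw [(r i).2]
    exact inv_mem (Subgroup.subset_normalClosure ⟨i, rfl⟩)
  exact hle hy

/-- The weak Schur `σ`-group `G_r = Fₙ / N_r` with `n` odd generators and `n` odd relations. -/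
def relGroup (p : ℕ) [Fact p.Prime] {n : ℕ} (r : Fin n → (freeSigmaProP p n).Odd) :
    SigmaProP p :=
  (freeSigmaProP p n).quot (relSubgroup p r) (relSubgroup_normal p r)
    (Subgroup.isClosed_topologicalClosure _) (relSubgroup_sigma p r)

/-- All tuples of odd relations in all `Fₙ`, up to `σ`-isomorphism of the groups they define. -/
def schSetoid (p : ℕ) [Fact p.Prime] : Setoid (Σ n : ℕ, Fin n → (freeSigmaProP p n).Odd) where
  r r s := (relGroup p r.2).Iso (relGroup p s.2)
  iseqv := ⟨fun _ => .refl _, fun h => h.symm, fun h h' => h.trans h'⟩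

/-- The set `Sch` of `σ`-isomorphism classes of the groups `G_r = Fₙ / N_r`, for all `n ≥ 0` and
all `n`-tuples `r` of odd elements of `Fₙ`. -/
def Sch (p : ℕ) [Fact p.Prime] : Type := Quotient (schSetoid p)

/-- The map `Θₙ : (Fₙ⁻)ⁿ → Sch`, `r ↦ [G_r]`. -/
def theta (p : ℕ) [Fact p.Prime] (n : ℕ) (r : Fin n → (freeSigmaProP p n).Odd) : Sch p :=
  Quotient.mk (schSetoid p) ⟨n, r⟩

/-- The set `Schₙ` of the classes `[G]` such that the minimal number of generators of `G` is
equal to `n`. -/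
def schGens (p : ℕ) [Fact p.Prime] (n : ℕ) : Set (Sch p) :=
  {x | ∃ (m : ℕ) (r : Fin m → (freeSigmaProP p m).Odd),
    x = theta p m r ∧ (relGroup p r).numGens = n}

/-- The set `U_{i,G}` of the classes `[H]` such that `H / Dᵢ(H)` and `G / Dᵢ(G)` are
`σ`-isomorphic. -/
def schBasic (p : ℕ) [Fact p.Prime] (i : ℕ) (G : SigmaProP p) : Set (Sch p) :=
  {x | ∃ (m : ℕ) (r : Fin m → (freeSigmaProP p m).Odd),
    x = theta p m r ∧ ((relGroup p r).modD i).Iso (G.modD i)}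

/-- The topology on `Sch` with basis the sets `U_{i,G}` for `i ≥ 2` and `[G] ∈ Sch`. -/
instance (p : ℕ) [Fact p.Prime] : TopologicalSpace (Sch p) :=
  TopologicalSpace.generateFrom
    {U | ∃ (i n : ℕ) (r : Fin n → (freeSigmaProP p n).Odd),
      2 ≤ i ∧ U = schBasic p i (relGroup p r)}

instance (p : ℕ) [Fact p.Prime] : MeasurableSpace (Sch p) := borel _

instance (p : ℕ) [Fact p.Prime] : BorelSpace (Sch p) := ⟨rfl⟩

/-! ### The measures -/

/-- The measure `μₙ` on `Sch`: the pushforward under `Θₙ` of the product of the Haar measures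
on the `n` factors of `(Fₙ⁻)ⁿ`. -/
noncomputable def mu (p : ℕ) [Fact p.Prime] (n : ℕ) : Measure (Sch p) :=
  (Measure.pi fun _ : Fin n => (freeSigmaProP p n).oddHaar).map (theta p n)

/-- `μ` is a probability measure on the Borel sets of `Sch`, and the measures `μₙ` converge to `μ`
for `n → ∞` (on every Borel set). -/
def IsMuInf (p : ℕ) [Fact p.Prime] (μ : Measure (Sch p)) : Prop :=
  IsProbabilityMeasure μ ∧
    ∀ A : Set (Sch p), MeasurableSet A → Tendsto (fun n => mu p n A) atTop (𝓝 (μ A))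

/-- `C_k = ∏_{i=1}^k (1 - p^{-i})`. -/
noncomputable def constC (p k : ℕ) : ℝ :=
  ∏ i ∈ Finset.Icc 1 k, (1 - ((p : ℝ) ^ i)⁻¹)

/-- `C_∞ = ∏_{i=1}^∞ (1 - p^{-i})`. -/
noncomputable def constCInf (p : ℕ) : ℝ :=
  ∏' i : ℕ, (1 - ((p : ℝ) ^ (i + 1))⁻¹)

/-!
The idea is to condition the relations `r₁, …, rₙ` one at a time on whether they lie in the Frattini
subgroup `D₂(Fₙ)`. A Haar distributed odd element of `Fₘ` lies there with probability `p⁻ᵐ`.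
If it does not, it belongs to a basis of odd elements of `Fₘ` (`FreeProP.exists_reduction`: the
Frattini argument yields a surjective endomorphism of `Fₘ` mapping a generator to it, and `Fₘ` is
Hopfian), so that it can be used to eliminate a generator: `G_r` does not change when `Fₘ` is
replaced by `Fₘ₋₁` and the other relations by their images, which are again independent and
distributed according to the respective Haar measures. Let `mixedMu p m k` be the law of `[G_r]` for
`m` relations in `Fₘ` of which `k` are arbitrary and `m - k` lie in the Frattini subgroup. Then
`mixedMu_succ` says
`mixedMu (m+1) (k+1) = p⁻⁽ᵐ⁺¹⁾ mixedMu (m+1) k + (1 - p⁻⁽ᵐ⁺¹⁾) mixedMu m k`.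

This recursion is solved explicitly: `μₙ` is the mixture of the measures `mixedMu p j 0` whose
weights are the probabilities `p^(-j²) Cₙ² / (Cⱼ² Cₙ₋ⱼ)` that a random `n × n`-matrix over `𝔽ₚ` has
corank `j`. As `n → ∞` the weights converge to `p^(-j²) C_∞ / Cⱼ²` and are dominated by a geometric
series, so `μₙ` converges on every Borel set to the mixture `muInf` with the limit weights. If all
relations lie in the Frattini subgroup of `Fⱼ`, then `G_r / D₂(G_r) ≅ Fⱼ / D₂(Fⱼ)`, and `G_r` needs
exactly `j` generators. Hence `mixedMu p j 0` is concentrated on `Schⱼ`, and the weight of `j` is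
the measure of `Schⱼ`.

Measurability of `Θₙ` follows from its continuity: the dimension subgroups `Dᵢ(Fₙ)` are open, and
`G_r / Dᵢ(G_r)` depends only on `r` modulo `Dᵢ(Fₙ)`.
-/

open scoped commutatorElement ENNReal

/-! ### Functoriality of the Zassenhaus filtration -/

theorem ceilDiv_lt_self {p : ℕ} (hp : 2 ≤ p) (n : ℕ) : (n + 2) ⌈/⌉ p < n + 2 := by
  rw [Nat.ceilDiv_eq_add_pred_div, Nat.div_lt_iff_lt_mul (by omega)]
  nlinarith [Nat.sub_le (n + 2 + p) 1, Nat.sub_add_cancel (show 1 ≤ n + 2 + p by omega)]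

section Functoriality

variable (p : ℕ) [hp : Fact p.Prime] {G H : Type} [Group G] [TopologicalSpace G]
  [IsTopologicalGroup G] [Group H] [TopologicalSpace H] [IsTopologicalGroup H]

theorem zassenhaus_map_le (f : G →* H) (hf : Continuous f) (n : ℕ) :
    (zassenhaus p G n).map f ≤ zassenhaus p H n := by
  induction n using Nat.strong_induction_on with
  | _ n ih =>
    match n with
    | 0 => rw [zassenhaus, zassenhaus]; exact le_top
    | 1 => rw [zassenhaus, zassenhaus]; exact le_top
    | n + 2 =>
      have key : ∀ (S : Subgroup G) (T : Subgroup H), S.map f ≤ T →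
          S.topologicalClosure.map f ≤ T.topologicalClosure := by
        rintro S T hS _ ⟨x, hx, rfl⟩
        exact map_mem_closure hf hx fun y hy => hS ⟨y, hy, rfl⟩
      rw [zassenhaus, zassenhaus]
      apply key
      rw [Subgroup.map_sup, Subgroup.map_iSup]
      refine sup_le_sup ?_ (iSup_mono fun i => ?_)
      · rw [MonoidHom.map_closure]
        apply Subgroup.closure_mono
        rintro _ ⟨_, ⟨x, hx, rfl⟩, rfl⟩
        exact ⟨f x, ih _ (ceilDiv_lt_self hp.out.two_le n) ⟨x, hx, rfl⟩, by simp⟩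
      · rw [Subgroup.map_commutator]
        exact Subgroup.commutator_mono (ih _ (by omega)) (ih _ (by omega))

/-- A continuous surjection from a compact group maps the dimension subgroups onto the dimension
subgroups. -/
theorem zassenhaus_le_map [CompactSpace G] [T2Space H] (f : G →* H) (hf : Continuous f)
    (hs : Function.Surjective f) (n : ℕ) :
    zassenhaus p H n ≤ (zassenhaus p G n).map f := by
  induction n using Nat.strong_induction_on with
  | _ n ih =>
    match n with
    | 0 => rw [zassenhaus, zassenhaus, Subgroup.map_top_of_surjective f hs]
    | 1 => rw [zassenhaus, zassenhaus, Subgroup.map_top_of_surjective f hs]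
    | n + 2 =>
      have hcl : IsClosed ((zassenhaus p G (n + 2)).map f : Set H) :=
        ((zassenhaus_isClosed p G (n + 2)).isCompact.image hf).isClosed
      rw [zassenhaus]
      refine Subgroup.topologicalClosure_minimal _ ?_ hcl
      rw [zassenhaus]
      refine le_trans ?_ (Subgroup.map_mono (Subgroup.le_topologicalClosure _))
      rw [Subgroup.map_sup, Subgroup.map_iSup]
      refine sup_le_sup ?_ (iSup_mono fun i => ?_)
      · rw [MonoidHom.map_closure]
        apply Subgroup.closure_mono
        rintro _ ⟨x, hx, rfl⟩
        obtain ⟨y, hy, rfl⟩ := ih _ (ceilDiv_lt_self hp.out.two_le n) hx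
        exact ⟨y ^ p, ⟨y, hy, rfl⟩, by simp⟩
      · rw [Subgroup.map_commutator]
        exact Subgroup.commutator_mono (ih _ (by omega)) (ih _ (by omega))

variable (G)

theorem zassenhaus_zero : zassenhaus p G 0 = ⊤ := by rw [zassenhaus]

theorem zassenhaus_one : zassenhaus p G 1 = ⊤ := by rw [zassenhaus]

variable {G}

theorem pow_mem_zassenhaus {n : ℕ} {x : G} (hx : x ∈ zassenhaus p G ((n + 2) ⌈/⌉ p)) :
    x ^ p ∈ zassenhaus p G (n + 2) := by
  rw [zassenhaus]
  exact Subgroup.le_topologicalClosure _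
    (Subgroup.mem_sup_left (Subgroup.subset_closure ⟨x, hx, rfl⟩))

theorem commutator_le_zassenhaus (i j : ℕ) :
    ⁅zassenhaus p G (i + 1), zassenhaus p G (j + 1)⁆ ≤ zassenhaus p G (i + j + 2) := by
  conv_rhs => rw [zassenhaus]
  refine le_trans ?_ (Subgroup.le_topologicalClosure _)
  refine le_sup_of_le_right (le_iSup_of_le ⟨i, by omega⟩ ?_)
  rw [show i + j + 1 - i = j + 1 by omega]

variable (G) in
theorem zassenhaus_antitone : Antitone (zassenhaus p G) := by
  suffices h : ∀ n m, m ≤ n → zassenhaus p G n ≤ zassenhaus p G m from fun m n hmn => h n m hmn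
  intro n
  induction n using Nat.strong_induction_on with
  | _ n ih =>
    intro m hm
    match n with
    | 0 => rw [Nat.le_zero.1 hm]
    | 1 =>
      interval_cases m
      · rw [zassenhaus_zero]; exact le_top
      · exact le_rfl
    | n + 2 =>
      rcases hm.eq_or_lt with rfl | hlt
      · exact le_rfl
      refine le_trans ?_ (ih (n + 1) (by omega) m (by omega))
      rcases n with _ | n
      · rw [zassenhaus_one]; exact le_top
      conv_lhs => rw [zassenhaus]
      refine Subgroup.topologicalClosure_minimal _ ?_ (zassenhaus_isClosed p G _)
      refine sup_le ?_ (iSup_le fun i => ?_)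
      · rw [Subgroup.closure_le]
        rintro _ ⟨x, hx, rfl⟩
        have h1 := ceilDiv_lt_self hp.out.two_le (n + 1)
        refine pow_mem_zassenhaus p (ih _ h1 ((n + 2) ⌈/⌉ p) ?_ hx)
        rw [Nat.ceilDiv_eq_add_pred_div, Nat.ceilDiv_eq_add_pred_div]
        exact Nat.div_le_div_right (by omega)
      · have hi := i.2
        rcases Nat.eq_zero_or_pos i.1 with h0 | h0
        · rw [h0]
          have := zassenhaus_normal p G (n + 2)
          exact Subgroup.commutator_le_right _ _
        · obtain ⟨j, hj⟩ := Nat.exists_eq_succ_of_ne_zero h0.ne'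
          rw [hj]
          refine le_trans (Subgroup.commutator_mono (ih _ (by omega) (j + 1) (by omega)) le_rfl) ?_
          have := commutator_le_zassenhaus p (G := G) j (n + 1 - (j + 1))
          rw [show j + (n + 1 - (j + 1)) + 2 = n + 2 by omega] at this
          rwa [show n + 1 + 1 - (j + 1) = n + 1 - (j + 1) + 1 by omega]

theorem pow_mem_zassenhaus_succ {n : ℕ} {x : G} (hx : x ∈ zassenhaus p G (n + 1)) :
    x ^ p ∈ zassenhaus p G (n + 2) := by
  refine pow_mem_zassenhaus p (zassenhaus_antitone p G ?_ hx)
  have := ceilDiv_lt_self hp.out.two_le n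
  omega

theorem zassenhaus_two_le {S : Subgroup G} (hS : IsClosed (S : Set G)) (h1 : ∀ x, x ^ p ∈ S)
    (h2 : ∀ x y : G, ⁅x, y⁆ ∈ S) : zassenhaus p G 2 ≤ S := by
  rw [zassenhaus]
  refine Subgroup.topologicalClosure_minimal _ ?_ hS
  refine sup_le ?_ (iSup_le fun i => ?_)
  · rw [Subgroup.closure_le]
    rintro _ ⟨x, -, rfl⟩
    exact h1 x
  · rw [Subgroup.commutator_le]
    exact fun x _ y _ => h2 x y

end Functoriality

/-! ### The Frattini argument -/

/-- A proper subgroup of a finite `p`-group is contained in a proper normal subgroup with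
elementary abelian quotient. -/
theorem IsPGroup.exists_normal_of_ne_top {p : ℕ} [hp : Fact p.Prime] {P : Type*} [Group P]
    [Finite P] (hP : IsPGroup p P) {H : Subgroup P} (hH : H ≠ ⊤) :
    ∃ M : Subgroup P, H ≤ M ∧ M ≠ ⊤ ∧ (∀ x, x ^ p ∈ M) ∧ ∀ x y : P, ⁅x, y⁆ ∈ M := by
  obtain h | ⟨M, hM, hHM⟩ := eq_top_or_exists_le_coatom H
  · exact absurd h hH
  have hnil := hP.isNilpotent
  have hn : M.Normal := Subgroup.NormalizerCondition.normal_of_coatom M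
    Group.normalizerCondition_of_isNilpotent hM
  have hPM : IsPGroup p (P ⧸ M) := hP.to_quotient M
  have hsimp : ∀ K : Subgroup (P ⧸ M), K = ⊥ ∨ K = ⊤ := by
    intro K
    have hK : M ≤ K.comap (QuotientGroup.mk' M) := by
      intro x hx
      rw [Subgroup.mem_comap, QuotientGroup.mk'_apply, (QuotientGroup.eq_one_iff x).2 hx]
      exact one_mem _
    have hKm := Subgroup.map_comap_eq_self_of_surjective (QuotientGroup.mk'_surjective M) K
    rcases hK.eq_or_lt with h | h
    · left
      rw [← hKm, ← h, QuotientGroup.map_mk'_self]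
    · right
      rw [← hKm, hM.2 _ h, Subgroup.map_top_of_surjective _ (QuotientGroup.mk'_surjective M)]
  have hnt : Nontrivial (P ⧸ M) := QuotientGroup.nontrivial_iff.2 hM.1
  have hcomm : ∀ x y : P ⧸ M, x * y = y * x := by
    have hc := hPM.center_nontrivial
    have : Subgroup.center (P ⧸ M) = ⊤ := (hsimp _).resolve_left
      ((Subgroup.nontrivial_iff_ne_bot _).1 hc)
    intro x y
    exact ((Subgroup.mem_center_iff.1 (this ▸ Subgroup.mem_top x)) y).symm
  have hpow : ∀ x : P ⧸ M, x ^ p = 1 := by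
    let _ : CommGroup (P ⧸ M) := { (inferInstance : Group (P ⧸ M)) with mul_comm := hcomm }
    rcases hsimp (powMonoidHom p : P ⧸ M →* P ⧸ M).range with h | h
    · intro x
      have : x ^ p ∈ (powMonoidHom p : P ⧸ M →* P ⧸ M).range := ⟨x, rfl⟩
      rwa [h, Subgroup.mem_bot] at this
    · exfalso
      have hs : Function.Surjective (powMonoidHom p : P ⧸ M →* P ⧸ M) :=
        MonoidHom.range_eq_top.1 h
      have hi := Finite.injective_iff_surjective.2 hs
      obtain ⟨x, hx⟩ := exists_ne (1 : P ⧸ M)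
      obtain ⟨k, hk⟩ := hPM x
      have : ∀ k, x ^ p ^ k ≠ 1 := by
        intro k
        induction k with
        | zero => simpa using hx
        | succ k ih =>
          intro h
          rw [pow_succ, pow_mul] at h
          exact ih (hi (by simpa using h))
      exact this k hk
  refine ⟨M, hHM, hM.1, fun x => ?_, fun x y => ?_⟩
  · rw [← QuotientGroup.eq_one_iff, QuotientGroup.mk_pow, hpow]
  · rw [← QuotientGroup.eq_one_iff]
    change QuotientGroup.mk' M ⁅x, y⁆ = 1
    rw [map_commutatorElement, commutatorElement_eq_one_iff_mul_comm, hcomm]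

/-- The Frattini argument: a closed subgroup that surjects onto `G / D₂(G)` is all of `G`. -/
theorem SigmaProP.eq_top_of_sup_zassenhaus_two {p : ℕ} [hp : Fact p.Prime] (G : SigmaProP p)
    (H : Subgroup G.carrier) (hc : IsClosed (H : Set G.carrier))
    (h : H ⊔ zassenhaus p G.carrier 2 = ⊤) : H = ⊤ := by
  by_contra hne
  obtain ⟨g, hg⟩ : ∃ g, g ∉ H := by
    by_contra! hall
    exact hne ((Subgroup.eq_top_iff' H).2 hall)
  have hU : (fun x => g * x) ⁻¹' (H : Set G.carrier)ᶜ ∈ 𝓝 (1 : G.carrier) := by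
    refine (hc.isOpen_compl.preimage (by fun_prop)).mem_nhds ?_
    simpa using hg
  obtain ⟨N, hNU, hN⟩ := G.basis _ hU
  have hfin : Finite (G.carrier ⧸ N.toSubgroup) := by
    have : DiscreteTopology (G.carrier ⧸ N.toSubgroup) := QuotientGroup.discreteTopology N.isOpen'
    exact finite_of_compact_of_discrete
  have hmap : H.map (QuotientGroup.mk' N.toSubgroup) ≠ ⊤ := by
    intro htop
    obtain ⟨y, hy, hyg⟩ := (Subgroup.eq_top_iff' _).1 htop (g : G.carrier ⧸ N.toSubgroup)
    have : g⁻¹ * y ∈ N.toSubgroup := QuotientGroup.eq.1 hyg.symm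
    have h1 := hNU this
    simp at h1
    exact h1 hy
  obtain ⟨M, hHM, hM, hpow, hcomm⟩ := hN.exists_normal_of_ne_top hmap
  apply hM
  have hcl : IsClosed (M.comap (QuotientGroup.mk' N.toSubgroup) : Set G.carrier) := by
    refine Subgroup.isClosed_of_isOpen _ (Subgroup.isOpen_mono (H₁ := N.toSubgroup) ?_ N.isOpen')
    intro x hx
    rw [Subgroup.mem_comap, QuotientGroup.mk'_apply, (QuotientGroup.eq_one_iff x).2 hx]
    exact one_mem _
  have h2 : zassenhaus p G.carrier 2 ≤ M.comap (QuotientGroup.mk' N.toSubgroup) := by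
    refine zassenhaus_two_le p hcl (fun x => ?_) fun x y => ?_
    · rw [Subgroup.mem_comap, map_pow]; exact hpow _
    · rw [Subgroup.mem_comap, map_commutatorElement]; exact hcomm _ _
  have h3 : M.comap (QuotientGroup.mk' N.toSubgroup) = ⊤ :=
    top_le_iff.1 (h ▸ sup_le (Subgroup.map_le_iff_le_comap.1 hHM) h2)
  rw [← Subgroup.map_comap_eq_self_of_surjective (QuotientGroup.mk'_surjective N.toSubgroup) M,
    h3, Subgroup.map_top_of_surjective _ (QuotientGroup.mk'_surjective _)]

/-! ### Isomorphisms between quotients -/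

namespace SigmaProP

section Projection

variable {p : ℕ} (G : SigmaProP p) (K : Subgroup G.carrier) (hn : K.Normal)
  (hc : IsClosed (K : Set G.carrier)) (hσ : ∀ x ∈ K, G.σ x ∈ K)

/-- The projection from `G` to a quotient, as a homomorphism into the carrier of `G.quot`. -/
def quotMk : G.carrier →* (G.quot K hn hc hσ).carrier := QuotientGroup.mk' K

theorem continuous_quotMk : Continuous (G.quotMk K hn hc hσ) :=
  QuotientGroup.continuous_mk (N := K)

theorem quotMk_surjective : Function.Surjective (G.quotMk K hn hc hσ) :=
  QuotientGroup.mk'_surjective K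

theorem ker_quotMk : (G.quotMk K hn hc hσ).ker = K := QuotientGroup.ker_mk' K

/-- The projection from `G` to `G / Dᵢ(G)`. -/
def modDMk [Fact p.Prime] (i : ℕ) : G.carrier →* (G.modD i).carrier :=
  G.quotMk _ (zassenhaus_normal p G.carrier i) (zassenhaus_isClosed p G.carrier i) _

theorem continuous_modDMk [Fact p.Prime] (i : ℕ) : Continuous (G.modDMk i) :=
  G.continuous_quotMk _ _ _ _

theorem modDMk_surjective [Fact p.Prime] (i : ℕ) : Function.Surjective (G.modDMk i) :=
  G.quotMk_surjective _ _ _ _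

theorem ker_modDMk [Fact p.Prime] (i : ℕ) : (G.modDMk i).ker = zassenhaus p G.carrier i :=
  G.ker_quotMk _ _ _ _

theorem modDMk_σ [Fact p.Prime] (i : ℕ) (x : G.carrier) :
    G.modDMk i (G.σ x) = (G.modD i).σ (G.modDMk i x) := rfl

end Projection

/-- Two quotients of the same group by the same kernel are `σ`-isomorphic. -/
theorem Iso.of_ker_eq {p : ℕ} {A B : SigmaProP p} {G : Type} [Group G]
    [TopologicalSpace G] [CompactSpace G] (s : G → G) (f : G →* A.carrier) (g : G →* B.carrier)
    (hf : Continuous f) (hg : Continuous g) (hfs : Function.Surjective f)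
    (hgs : Function.Surjective g) (hfσ : ∀ x, f (s x) = A.σ (f x))
    (hgσ : ∀ x, g (s x) = B.σ (g x)) (hker : f.ker = g.ker) : A.Iso B := by
  let e : A.carrier ≃* B.carrier := (QuotientGroup.quotientKerEquivOfSurjective f hfs).symm.trans
    ((QuotientGroup.quotientMulEquivOfEq hker).trans
      (QuotientGroup.quotientKerEquivOfSurjective g hgs))
  have he : ∀ x, e (f x) = g x := by
    intro x
    have : (QuotientGroup.quotientKerEquivOfSurjective f hfs).symm (f x) = (x : G ⧸ f.ker) := by
      rw [MulEquiv.symm_apply_eq]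
      rfl
    simp only [e, MulEquiv.trans_apply, this]
    rfl
  have hq : Topology.IsQuotientMap f := hf.isClosedMap.isQuotientMap hf hfs
  have hec : Continuous e := by
    rw [hq.continuous_iff]
    exact hg.congr fun x => (he x).symm
  have hes : Continuous e.symm := (hec.homeoOfEquivCompactToT2 (f := e.toEquiv)).symm.continuous
  refine ⟨⟨e, hec, hes⟩, fun y => ?_⟩
  obtain ⟨x, rfl⟩ := hfs y
  change e (A.σ (f x)) = B.σ (e (f x))
  rw [← hfσ, he, he, hgσ]

theorem Iso.modD {p : ℕ} [Fact p.Prime] {A B : SigmaProP p} (h : A.Iso B) (i : ℕ) :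
    (A.modD i).Iso (B.modD i) := by
  obtain ⟨e, he⟩ := h
  refine .of_ker_eq A.σ (A.modDMk i) ((B.modDMk i).comp e.toMulEquiv.toMonoidHom)
    (A.continuous_modDMk i) ((B.continuous_modDMk i).comp e.continuous_toFun)
    (A.modDMk_surjective i) ((B.modDMk_surjective i).comp e.surjective) (A.modDMk_σ i)
    (fun x => ?_) ?_
  · exact congrArg (B.modDMk i) (he x)
  · rw [← MonoidHom.comap_ker, ker_modDMk, ker_modDMk]
    refine le_antisymm ?_ fun x hx => ?_
    · exact Subgroup.map_le_iff_le_comap.1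
        (zassenhaus_map_le p e.toMulEquiv.toMonoidHom e.continuous_toFun i)
    · have := zassenhaus_map_le p e.symm.toMulEquiv.toMonoidHom e.symm.continuous_toFun i
        ⟨_, hx, rfl⟩
      change e.symm (e x) ∈ _ at this
      rwa [ContinuousMulEquiv.symm_apply_apply] at this

end SigmaProP

/-! ### The free pro-`p`-group: generators and homomorphisms -/

namespace FreeProP

theorem continuous_comp {A B C : Type*} [Group A] [Group B] [Group C] [TopologicalSpace A]
    [TopologicalSpace B] [TopologicalSpace C] {g : B →* C} {f : A →* B} (hg : Continuous g)
    (hf : Continuous f) : Continuous (g.comp f) :=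
  hg.comp hf

theorem isPGroup_level {p m : ℕ} (N : PIndex p m) : IsPGroup p (Level p m N) := by
  obtain ⟨k, hk⟩ := N.2.2
  exact IsPGroup.of_card (n := k) (hk ▸ rfl)

variable {p : ℕ} [hp : Fact p.Prime] {m n : ℕ}

instance (N : PIndex p m) : Finite (Level p m N) := level_finite p m N

/-- The projection from the free pro-`p`-group to one of the finite groups defining it. -/
def proj (N : PIndex p m) : (freeSigmaProP p m).carrier →* Level p m N :=
  (Pi.evalMonoidHom _ N).comp (freeProP p m).subtype

theorem continuous_proj (N : PIndex p m) : Continuous (proj N) :=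
  (continuous_apply N).comp continuous_subtype_val

theorem ext_proj {x y : (freeSigmaProP p m).carrier} (h : ∀ N, proj N x = proj N y) : x = y :=
  Subtype.ext (funext h)

theorem levelMap_proj {N M : PIndex p m} (h : N.1 ≤ M.1) (x : (freeSigmaProP p m).carrier) :
    levelMap p m h (proj N x) = proj M x := x.2 N M h

variable (p) in
/-- The homomorphism from the abstract free group to the free pro-`p`-group. -/
def of : FreeGroup (Fin m) →* (freeSigmaProP p m).carrier where
  toFun w := ⟨fun N => (QuotientGroup.mk w : FreeGroup (Fin m) ⧸ N.1), fun _ _ _ => rfl⟩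
  map_one' := rfl
  map_mul' _ _ := rfl

variable (p) in
/-- The free generators `x₁, …, xₘ`. -/
def gen (i : Fin m) : (freeSigmaProP p m).carrier := of p (FreeGroup.of i)

theorem σ_of (w : FreeGroup (Fin m)) :
    (freeSigmaProP p m).σ (of p w) = of p (freeFlip m w) := rfl

theorem σ_gen (i : Fin m) : (freeSigmaProP p m).σ (gen p i) = (gen p i)⁻¹ := by
  rw [gen, σ_of, freeFlip, FreeGroup.lift_apply_of, map_inv]

theorem exists_pIndex_le (I : Finset (PIndex p m)) : ∃ M : PIndex p m, ∀ N ∈ I, M.1 ≤ N.1 := by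
  classical
  induction I using Finset.induction_on with
  | empty => exact ⟨⟨⊤, inferInstance, 0, by simp⟩, by simp⟩
  | insert N I _ ih =>
    obtain ⟨M, hM⟩ := ih
    have hker : ((QuotientGroup.mk' N.1).prod (QuotientGroup.mk' M.1)).ker = N.1 ⊓ M.1 := by
      ext x
      simp [MonoidHom.mem_ker]
    have hfin : Finite (FreeGroup (Fin m) ⧸ N.1) := level_finite p m N
    have hfin' : Finite (FreeGroup (Fin m) ⧸ M.1) := level_finite p m M
    have hP : IsPGroup p ((FreeGroup (Fin m) ⧸ N.1) × (FreeGroup (Fin m) ⧸ M.1)) := by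
      obtain ⟨k, hk⟩ := N.2.2
      obtain ⟨l, hl⟩ := M.2.2
      refine IsPGroup.of_card (n := k + l) ?_
      rw [Nat.card_prod, pow_add, ← hk, ← hl]
      rfl
    obtain ⟨k, hk⟩ := IsPGroup.iff_card.1
      (hP.to_subgroup ((QuotientGroup.mk' N.1).prod (QuotientGroup.mk' M.1)).range)
    refine ⟨⟨N.1 ⊓ M.1, inferInstance, k, ?_⟩, ?_⟩
    · rw [← hker, Subgroup.index_ker, hk]
    · intro K hK
      rcases Finset.mem_insert.1 hK with rfl | hK
      · exact inf_le_left
      · exact inf_le_right.trans (hM K hK)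

theorem denseRange_of : DenseRange (of p : FreeGroup (Fin m) → (freeSigmaProP p m).carrier) := by
  intro x
  rw [mem_closure_iff_nhds]
  intro U hU
  obtain ⟨V, hV, hVU⟩ := mem_nhds_subtype _ _ _ |>.1 hU
  rw [nhds_pi, Filter.mem_pi] at hV
  obtain ⟨I, hI, t, ht, htV⟩ := hV
  obtain ⟨M, hM⟩ := exists_pIndex_le hI.toFinset
  obtain ⟨w, hw⟩ := QuotientGroup.mk'_surjective M.1 (proj M x)
  refine ⟨of p w, hVU (htV fun N hN => ?_), w, rfl⟩
  have h := hM N (hI.mem_toFinset.2 hN)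
  have h1 : proj N (of p w) = proj N x := by
    rw [← levelMap_proj h x, ← hw]
    rfl
  change proj N (of p w) ∈ t N
  rw [h1]
  exact mem_of_mem_nhds (ht N)

theorem hom_ext_of {H : Type*} [Group H] [TopologicalSpace H] [T2Space H]
    {f g : (freeSigmaProP p m).carrier →* H} (hf : Continuous f) (hg : Continuous g)
    (h : f.comp (of p) = g.comp (of p)) : f = g := by
  have := denseRange_of.equalizer hf hg (funext fun w => DFunLike.congr_fun h w)
  exact DFunLike.coe_injective this

theorem hom_ext {H : Type*} [Group H] [TopologicalSpace H] [T2Space H]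
    {f g : (freeSigmaProP p m).carrier →* H} (hf : Continuous f) (hg : Continuous g)
    (h : ∀ i, f (gen p i) = g (gen p i)) : f = g :=
  hom_ext_of hf hg (FreeGroup.ext_hom _ _ h)

theorem equivariant_of_gen {G : SigmaProP p} {f : (freeSigmaProP p m).carrier →* G.carrier}
    (hf : Continuous f) (h : ∀ i, G.σ (f (gen p i)) = (f (gen p i))⁻¹)
    (x : (freeSigmaProP p m).carrier) : f ((freeSigmaProP p m).σ x) = G.σ (f x) := by
  have : f.comp (freeSigmaProP p m).σ.toMonoidHom = G.σ.toMonoidHom.comp f := by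
    refine hom_ext (hf.comp (freeSigmaProP p m).σ.continuous_toFun)
      (G.σ.continuous_toFun.comp hf) fun i => ?_
    change f ((freeSigmaProP p m).σ (gen p i)) = G.σ (f (gen p i))
    rw [σ_gen, map_inv, h]
  exact DFunLike.congr_fun this x

/-- Homomorphisms to finite `p`-groups extend from the abstract free group to the free
pro-`p`-group. -/
theorem exists_finite_lift {P : Type*} [Group P] [Finite P] (hP : IsPGroup p P)
    (φ : FreeGroup (Fin m) →* P) :
    ∃ ψ : (freeSigmaProP p m).carrier →* P, ψ.comp (of p) = φ ∧
      ∀ _ : TopologicalSpace P, Continuous ψ := by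
  obtain ⟨k, hk⟩ := IsPGroup.iff_card.1 (hP.to_subgroup φ.range)
  let N : PIndex p m := ⟨φ.ker, inferInstance, k, by rw [Subgroup.index_ker, hk]⟩
  let l : Level p m N →* P := QuotientGroup.kerLift φ
  exact ⟨l.comp (proj N), rfl, fun _ =>
    (continuous_of_discreteTopology (f := l)).comp (continuous_proj N)⟩

/-- The universal property of the free pro-`p`-group, for targets of the same kind. -/
theorem exists_lift (a : Fin m → (freeSigmaProP p n).carrier) :
    ∃ φ : (freeSigmaProP p m).carrier →* (freeSigmaProP p n).carrier,
      Continuous φ ∧ ∀ i, φ (gen p i) = a i := by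
  let φ₀ : FreeGroup (Fin m) →* (freeSigmaProP p n).carrier := FreeGroup.lift a
  choose ψ hψ hψc using fun N : PIndex p n =>
    exists_finite_lift (isPGroup_level N) ((proj N).comp φ₀)
  have hcompat : ∀ (N M : PIndex p n) (h : N.1 ≤ M.1), (levelMap p n h).comp (ψ N) = ψ M := by
    intro N M h
    refine hom_ext_of (continuous_comp (continuous_of_discreteTopology (f := levelMap p n h)) (hψc N _))
      (hψc M _) ?_
    rw [MonoidHom.comp_assoc, hψ, hψ]
    ext i
    exact levelMap_proj h (φ₀ (FreeGroup.of i))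
  let φ : (freeSigmaProP p m).carrier →* (freeSigmaProP p n).carrier :=
    (MonoidHom.pi ψ).codRestrict (freeProP p n)
      fun x N M h => DFunLike.congr_fun (hcompat N M h) x
  refine ⟨φ, Continuous.subtype_mk (continuous_pi fun N => hψc N _) _, fun i => ext_proj fun N => ?_⟩
  have h1 : proj N (φ₀ (FreeGroup.of i)) = proj N (a i) := by
    simp only [φ₀, FreeGroup.lift_apply_of]
  exact (DFunLike.congr_fun (hψ N) (FreeGroup.of i)).trans h1

/-- The free pro-`p`-group is Hopfian: for a finite `p`-group `P` there are only finitely many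
homomorphisms to `P`, so the injective map `ψ ↦ ψ ∘ β` on them is bijective, and the projections
to the finite levels factor through `β`. -/
theorem injective_of_surjective
    {β : (freeSigmaProP p m).carrier →* (freeSigmaProP p m).carrier} (hβ : Continuous β)
    (hs : Function.Surjective β) : Function.Injective β := by
  have key : ∀ N : PIndex p m, ∃ ψ : (freeSigmaProP p m).carrier →* Level p m N,
      ψ.comp β = proj N := by
    intro N
    choose ψ hψ hψc using fun φ : FreeGroup (Fin m) →* Level p m N =>
      exists_finite_lift (isPGroup_level N) φ
    have hfin : Finite (FreeGroup (Fin m) →* Level p m N) :=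
      Finite.of_equiv _ (FreeGroup.lift (α := Fin m) (β := Level p m N))
    have hinj : Function.Injective
        fun φ : FreeGroup (Fin m) →* Level p m N => ((ψ φ).comp β).comp (of p) := by
      intro φ φ' h
      have h1 := hom_ext_of (continuous_comp (hψc φ _) hβ) (continuous_comp (hψc φ' _) hβ) h
      have h2 : ψ φ = ψ φ' := by
        ext x
        obtain ⟨y, rfl⟩ := hs x
        exact DFunLike.congr_fun h1 y
      rw [← hψ φ, ← hψ φ', h2]
    obtain ⟨φ, hφ⟩ := Finite.injective_iff_surjective.1 hinj ((proj N).comp (of p))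
    exact ⟨ψ φ, hom_ext_of (continuous_comp (hψc φ _) hβ) (continuous_proj N) hφ⟩
  intro x y hxy
  refine ext_proj fun N => ?_
  obtain ⟨ψ, hψ⟩ := key N
  rw [← hψ, MonoidHom.comp_apply, MonoidHom.comp_apply, hxy]

/-- The closed normal subgroup generated by one element. -/
def closedNormalClosure {G : Type*} [Group G] [TopologicalSpace G] [IsTopologicalGroup G] (a : G) :
    Subgroup G :=
  (Subgroup.normalClosure {a}).topologicalClosure

instance {G : Type*} [Group G] [TopologicalSpace G] [IsTopologicalGroup G] (a : G) :
    (closedNormalClosure a).Normal :=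
  Subgroup.is_normal_topologicalClosure _

theorem mem_closedNormalClosure {G : Type*} [Group G] [TopologicalSpace G] [IsTopologicalGroup G]
    (a : G) : a ∈ closedNormalClosure a :=
  Subgroup.le_topologicalClosure _ (Subgroup.subset_normalClosure rfl)

theorem closedNormalClosure_le {G : Type*} [Group G] [TopologicalSpace G] [IsTopologicalGroup G]
    {a : G} {N : Subgroup G} [N.Normal] (hN : IsClosed (N : Set G)) (ha : a ∈ N) :
    closedNormalClosure a ≤ N :=
  Subgroup.topologicalClosure_minimal _ (Subgroup.normalClosure_le_normal (by simpa using ha)) hN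

/-- Killing the generator `xᵢ` of `Fₘ₊₁` yields `Fₘ`. -/
theorem exists_kill (i : Fin (m + 1)) :
    ∃ κ : (freeSigmaProP p (m + 1)).carrier →* (freeSigmaProP p m).carrier,
      Continuous κ ∧ Function.Surjective κ ∧ κ (gen p i) = 1 ∧
      (∀ j, κ (gen p (i.succAbove j)) = gen p j) ∧
      κ.ker ≤ closedNormalClosure (gen p i) := by
  obtain ⟨κ, hκ, hκg⟩ := exists_lift (p := p) (i.insertNth (α := fun _ => _) 1 (gen p (m := m)))
  obtain ⟨ι, hι, hιg⟩ := exists_lift (p := p) fun j => gen p (i.succAbove j)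
  have h1 : κ (gen p i) = 1 := by rw [hκg, Fin.insertNth_apply_same]
  have h2 : ∀ j, κ (gen p (i.succAbove j)) = gen p j := fun j => by
    rw [hκg, Fin.insertNth_apply_succAbove]
  have h3 : κ.comp ι = MonoidHom.id _ := hom_ext (hκ.comp hι) continuous_id fun j => by
    rw [MonoidHom.comp_apply, hιg, h2]
    rfl
  refine ⟨κ, hκ, fun x => ⟨ι x, DFunLike.congr_fun h3 x⟩, h1, h2, fun x hx => ?_⟩
  let N := closedNormalClosure (gen p i)
  have hNc : IsClosed (N : Set (freeSigmaProP p (m + 1)).carrier) :=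
    Subgroup.isClosed_topologicalClosure _
  have hq : Continuous (QuotientGroup.mk' N) := QuotientGroup.continuous_mk
  have h4 : (QuotientGroup.mk' N).comp (ι.comp κ) = QuotientGroup.mk' N := by
    refine hom_ext (hq.comp (hι.comp hκ)) hq fun j => ?_
    rcases Fin.eq_self_or_eq_succAbove i j with rfl | ⟨j, rfl⟩
    · rw [MonoidHom.comp_apply, MonoidHom.comp_apply, h1, map_one, map_one]
      exact ((QuotientGroup.eq_one_iff _).2 (mem_closedNormalClosure _)).symm
    · rw [MonoidHom.comp_apply, MonoidHom.comp_apply, h2, hιg]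
  have h5 := DFunLike.congr_fun h4 x
  rw [MonoidHom.comp_apply, MonoidHom.comp_apply, MonoidHom.mem_ker.1 hx, map_one, map_one] at h5
  exact (QuotientGroup.eq_one_iff _).1 h5.symm

/-! ### Countability -/

instance : Countable (PIndex p m) := by
  have h : ∀ N : PIndex p m, ∃ s : Finset (FreeGroup (Fin m)), Subgroup.closure s = N.1 := by
    intro N
    obtain ⟨k, hk⟩ := N.2.2
    have : N.1.FiniteIndex := ⟨by rw [hk]; exact pow_ne_zero _ hp.out.ne_zero⟩
    have : Group.FG N.1 := inferInstance
    exact (Group.fg_iff_subgroup_fg N.1).1 this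
  choose s hs using h
  have : Countable (FreeGroup (Fin m)) := by
    unfold FreeGroup
    exact Quotient.countable
  refine Function.Injective.countable (f := s) fun N M h => Subtype.ext ?_
  rw [← hs N, ← hs M, h]

instance : SecondCountableTopology (freeSigmaProP p m).carrier :=
  TopologicalSpace.Subtype.secondCountableTopology (α := ∀ N : PIndex p m, Level p m N) _

instance : SecondCountableTopology (freeSigmaProP p m).Odd :=
  TopologicalSpace.Subtype.secondCountableTopology _

end FreeProP

/-! ### Coordinates modulo the second dimension subgroup -/

namespace FreeProP

section Coordinates

variable {p : ℕ} [hp : Fact p.Prime] {m n : ℕ}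

theorem isPGroup_pi_zmod :
    IsPGroup p (Fin m → Multiplicative (ZMod p)) := by
  refine IsPGroup.of_card (n := m) ?_
  rw [Nat.card_fun, Nat.card_fin, Nat.card_congr Multiplicative.toAdd, Nat.card_zmod]

variable (p m) in
theorem exists_coord : ∃ c : (freeSigmaProP p m).carrier →* (Fin m → Multiplicative (ZMod p)),
    (∀ i, c (gen p i) = Pi.mulSingle i (Multiplicative.ofAdd 1)) ∧
      ∀ _ : TopologicalSpace (Fin m → Multiplicative (ZMod p)), Continuous c := by
  obtain ⟨c, hc, hcc⟩ := exists_finite_lift (p := p) isPGroup_pi_zmod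
    (FreeGroup.lift fun i : Fin m =>
      (Pi.mulSingle i (Multiplicative.ofAdd 1) : Fin m → Multiplicative (ZMod p)))
  refine ⟨c, fun i => ?_, hcc⟩
  have := DFunLike.congr_fun hc (FreeGroup.of i)
  rwa [FreeGroup.lift_apply_of] at this

variable (p m) in
/-- The homomorphism to `𝔽ₚᵐ`, written multiplicatively, that maps the free generators to the
standard basis. -/
noncomputable def coord : (freeSigmaProP p m).carrier →* (Fin m → Multiplicative (ZMod p)) :=
  (exists_coord p m).choose

theorem coord_gen (i : Fin m) :
    coord p m (gen p i) = Pi.mulSingle i (Multiplicative.ofAdd 1) :=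
  (exists_coord p m).choose_spec.1 i

theorem isOpen_ker_coord : IsOpen ((coord p m).ker : Set (freeSigmaProP p m).carrier) := by
  let _ : TopologicalSpace (Fin m → Multiplicative (ZMod p)) := ⊥
  have : DiscreteTopology (Fin m → Multiplicative (ZMod p)) := ⟨rfl⟩
  exact (isOpen_discrete {1}).preimage ((exists_coord p m).choose_spec.2 ⊥)

theorem pow_pi_zmod (v : Fin m → Multiplicative (ZMod p)) : v ^ p = 1 := by
  ext i
  apply Multiplicative.toAdd.injective
  rw [Pi.pow_apply, Pi.one_apply, toAdd_pow, nsmul_eq_mul, CharP.cast_eq_zero, zero_mul, toAdd_one]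

theorem coord_gen_pow (i : Fin m) (c : Multiplicative (ZMod p)) :
    coord p m (gen p i ^ c.toAdd.val) = Pi.mulSingle i c := by
  rw [map_pow, coord_gen, ← Pi.mulSingle_pow, ← ofAdd_nsmul, nsmul_one, ZMod.natCast_zmod_val,
    ofAdd_toAdd]

theorem coord_surjective : Function.Surjective (coord p m) := by
  rw [← MonoidHom.range_eq_top, Subgroup.eq_top_iff']
  intro v
  exact Subgroup.pi_mem_of_mulSingle_mem v fun i => ⟨_, coord_gen_pow i (v i)⟩

/-- The universal property of `𝔽ₚᵏ` among abelian groups of exponent `p`. -/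
theorem exists_pi_zmod_hom {Q : Type*} [CommGroup Q] (hpow : ∀ y : Q, y ^ p = 1)
    {k : ℕ} (u : Fin k → Q) :
    ∃ s : (Fin k → Multiplicative (ZMod p)) →* Q,
      ∀ j, s (Pi.mulSingle j (Multiplicative.ofAdd 1)) = u j := by
  let s : (Fin k → Multiplicative (ZMod p)) →* Q :=
    { toFun := fun v => ∏ i, u i ^ (v i).toAdd.val
      map_one' := by simp
      map_mul' := fun v w => by
        rw [← Finset.prod_mul_distrib]
        refine Finset.prod_congr rfl fun i _ => ?_
        rw [Pi.mul_apply, toAdd_mul, ZMod.val_add, ← pow_eq_pow_mod _ (hpow _), pow_add] }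
  refine ⟨s, fun i => ?_⟩
  change ∏ j, u j ^ ((Pi.mulSingle i (Multiplicative.ofAdd 1) :
    Fin k → Multiplicative (ZMod p)) j).toAdd.val = _
  rw [Finset.prod_eq_single i]
  · have : Fact (1 < p) := ⟨hp.out.one_lt⟩
    rw [Pi.mulSingle_eq_same, toAdd_ofAdd, ZMod.val_one, pow_one]
  · intro j _ hj
    rw [Pi.mulSingle_eq_of_ne hj, toAdd_one, ZMod.val_zero, pow_zero]
  · simp

theorem zassenhaus_two_eq_ker_coord :
    zassenhaus p (freeSigmaProP p m).carrier 2 = (coord p m).ker := by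
  apply le_antisymm
  · refine zassenhaus_two_le p (Subgroup.isClosed_of_isOpen _ isOpen_ker_coord)
      (fun x => ?_) fun x y => ?_
    · rw [MonoidHom.mem_ker, map_pow, pow_pi_zmod]
    · rw [MonoidHom.mem_ker, map_commutatorElement, commutatorElement_eq_one_iff_mul_comm, mul_comm]
  · intro x hx
    -- The abelian group `Q = F / D₂(F)` has exponent `p`, so `eᵢ ↦ xᵢ` defines a homomorphism
    -- from `𝔽ₚᵐ` to `Q`; the projection to `Q` factors through it.
    let Q := ((freeSigmaProP p m).modD 2).carrier
    let q : (freeSigmaProP p m).carrier →* Q := (freeSigmaProP p m).modDMk 2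
    have hqs : Function.Surjective q := (freeSigmaProP p m).modDMk_surjective 2
    have hqk : q.ker = zassenhaus p (freeSigmaProP p m).carrier 2 :=
      (freeSigmaProP p m).ker_modDMk 2
    have hpow : ∀ y : Q, y ^ p = 1 := by
      intro y
      obtain ⟨x, rfl⟩ := hqs y
      rw [← map_pow, ← MonoidHom.mem_ker, hqk]
      exact pow_mem_zassenhaus_succ p (n := 0) (by rw [zassenhaus_one]; trivial)
    have hcomm : ∀ y z : Q, y * z = z * y := by
      intro y z
      obtain ⟨x, rfl⟩ := hqs y
      obtain ⟨x', rfl⟩ := hqs z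
      rw [← commutatorElement_eq_one_iff_mul_comm, ← map_commutatorElement, ← MonoidHom.mem_ker,
        hqk]
      refine commutator_le_zassenhaus p 0 0 (Subgroup.commutator_mem_commutator ?_ ?_)
      all_goals rw [zassenhaus_one]; trivial
    let _ : CommGroup Q := { (inferInstance : Group Q) with mul_comm := hcomm }
    obtain ⟨s, hsg⟩ := exists_pi_zmod_hom hpow fun i => q (gen p i)
    have hs : s.comp (coord p m) = q := by
      refine hom_ext ?_ ((freeSigmaProP p m).continuous_modDMk 2) fun i => ?_
      · let _ : TopologicalSpace (Fin m → Multiplicative (ZMod p)) := ⊥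
        have : DiscreteTopology (Fin m → Multiplicative (ZMod p)) := ⟨rfl⟩
        exact continuous_comp (continuous_of_discreteTopology (f := s))
          ((exists_coord p m).choose_spec.2 ⊥)
      · rw [MonoidHom.comp_apply, coord_gen, hsg]
    rw [← hqk, MonoidHom.mem_ker, ← hs, MonoidHom.comp_apply, MonoidHom.mem_ker.1 hx, map_one]

theorem index_zassenhaus_two : (zassenhaus p (freeSigmaProP p m).carrier 2).index = p ^ m := by
  rw [zassenhaus_two_eq_ker_coord, Subgroup.index_ker,
    MonoidHom.range_eq_top.2 coord_surjective, Subgroup.card_top, Nat.card_fun, Nat.card_fin,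
    Nat.card_congr Multiplicative.toAdd, Nat.card_zmod]

/-- An odd element outside the Frattini subgroup is a member of a basis of odd elements, and
killing it yields the free pro-`p`-group with one generator fewer. -/
theorem exists_reduction (a : (freeSigmaProP p (m + 1)).Odd)
    (ha : a.1 ∉ zassenhaus p (freeSigmaProP p (m + 1)).carrier 2) :
    ∃ π : (freeSigmaProP p (m + 1)).carrier →* (freeSigmaProP p m).carrier,
      Continuous π ∧ Function.Surjective π ∧
      (∀ x, π ((freeSigmaProP p (m + 1)).σ x) = (freeSigmaProP p m).σ (π x)) ∧
      π a.1 = 1 ∧ π.ker ≤ closedNormalClosure a.1 := by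
  rw [zassenhaus_two_eq_ker_coord, MonoidHom.mem_ker] at ha
  obtain ⟨i, hi⟩ := Function.ne_iff.1 ha
  obtain ⟨β, hβ, hβg⟩ := exists_lift (p := p)
    (i.insertNth (α := fun _ => _) a.1 fun j => gen p (i.succAbove j))
  have hβi : β (gen p i) = a.1 := by rw [hβg, Fin.insertNth_apply_same]
  have hβj : ∀ j, β (gen p (i.succAbove j)) = gen p (i.succAbove j) := fun j => by
    rw [hβg, Fin.insertNth_apply_succAbove]
  have hβσ := equivariant_of_gen hβ fun j => by
    rcases Fin.eq_self_or_eq_succAbove i j with rfl | ⟨j, rfl⟩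
    · rw [hβi, a.2]
    · rw [hβj, σ_gen]
  have hmap : β.range.map (coord p (m + 1)) = ⊤ := by
    have hj : ∀ j, j ≠ i → ∀ c, Pi.mulSingle j c ∈ β.range.map (coord p (m + 1)) := by
      intro j hj c
      obtain ⟨j, rfl⟩ := Fin.exists_succAbove_eq hj
      refine ⟨_, ⟨gen p (i.succAbove j) ^ c.toAdd.val, rfl⟩, ?_⟩
      rw [map_pow, hβj, coord_gen_pow]
    have hi1 : Pi.mulSingle i (coord p (m + 1) a.1 i) ∈ β.range.map (coord p (m + 1)) := by
      have h1 : coord p (m + 1) a.1 ∈ β.range.map (coord p (m + 1)) :=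
        ⟨_, ⟨gen p i, hβi⟩, rfl⟩
      rw [← Finset.univ_prod_mulSingle (coord p (m + 1) a.1),
        ← Finset.mul_prod_erase _ _ (Finset.mem_univ i)] at h1
      refine (Subgroup.mul_mem_cancel_right _ (Subgroup.prod_mem _ fun j hji => ?_)).1 h1
      exact hj j (Finset.ne_of_mem_erase hji) _
    have hi2 : ∀ c, Pi.mulSingle i c ∈ β.range.map (coord p (m + 1)) := by
      intro c
      have := Subgroup.pow_mem _ hi1 (c.toAdd / (coord p (m + 1) a.1 i).toAdd).val
      rw [← Pi.mulSingle_pow] at this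
      suffices h : c = coord p (m + 1) a.1 i ^
          (c.toAdd / (coord p (m + 1) a.1 i).toAdd).val by rwa [← h] at this
      apply Multiplicative.toAdd.injective
      rw [toAdd_pow, nsmul_eq_mul, ZMod.natCast_zmod_val, div_mul_cancel₀]
      exact fun h => hi (Multiplicative.toAdd.injective h)
    rw [Subgroup.eq_top_iff']
    intro v
    refine Subgroup.pi_mem_of_mulSingle_mem v fun j => ?_
    by_cases h : j = i
    · subst h; exact hi2 _
    · exact hj j h _
  have hβs : Function.Surjective β := by
    rw [← MonoidHom.range_eq_top]
    apply SigmaProP.eq_top_of_sup_zassenhaus_two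
    · exact (isCompact_range hβ).isClosed
    · rw [zassenhaus_two_eq_ker_coord, ← Subgroup.comap_map_eq, hmap, Subgroup.comap_top]
  let e : (freeSigmaProP p (m + 1)).carrier ≃* (freeSigmaProP p (m + 1)).carrier :=
    MulEquiv.ofBijective β ⟨injective_of_surjective hβ hβs, hβs⟩
  have heβ : ∀ x, e x = β x := fun _ => rfl
  have hec : Continuous e.symm :=
    (Continuous.homeoOfEquivCompactToT2 (f := e.toEquiv) hβ).symm.continuous
  obtain ⟨κ, hκ, hκs, hκi, hκj, hκk⟩ := exists_kill (p := p) i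
  have hκσ := equivariant_of_gen hκ fun j => by
    rcases Fin.eq_self_or_eq_succAbove i j with rfl | ⟨j, rfl⟩
    · rw [hκi, map_one, inv_one]
    · rw [hκj, σ_gen]
  refine ⟨κ.comp e.symm.toMonoidHom, hκ.comp hec, hκs.comp e.symm.surjective, fun x => ?_, ?_, ?_⟩
  · obtain ⟨x, rfl⟩ := e.surjective x
    change κ (e.symm ((freeSigmaProP p (m + 1)).σ (e x))) =
      (freeSigmaProP p m).σ (κ (e.symm (e x)))
    rw [e.symm_apply_apply, heβ, ← hβσ, ← heβ, e.symm_apply_apply, hκσ]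
  · change κ (e.symm a.1) = 1
    rw [← hβi, ← heβ, e.symm_apply_apply, hκi]
  · intro x hx
    have h1 : e.symm x ∈ closedNormalClosure (gen p i) := hκk hx
    have h2 : closedNormalClosure (gen p i) ≤ (closedNormalClosure a.1).comap β := by
      refine closedNormalClosure_le ?_ ?_
      · exact (Subgroup.isClosed_topologicalClosure _).preimage hβ
      · rw [Subgroup.mem_comap, hβi]
        exact mem_closedNormalClosure _
    have h3 : β (e.symm x) ∈ closedNormalClosure a.1 := h2 h1
    rwa [← heβ, e.apply_symm_apply] at h3

end Coordinates

/-! ### Openness of the dimension subgroups and continuity of `Θₙ` -/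

variable {p : ℕ} [hp : Fact p.Prime] {m n : ℕ}

/-- The quotient `Dₙ₊₁(F) / Dₙ₊₂(F)` is an abelian group of exponent `p`; it is finite, because
`Dₙ₊₁(F)` is topologically generated by its intersection with the abstract free group, which
is finitely generated by Schreier's lemma. -/
theorem isOpen_zassenhaus (n : ℕ) :
    IsOpen (zassenhaus p (freeSigmaProP p m).carrier n : Set (freeSigmaProP p m).carrier) := by
  induction n with
  | zero => rw [zassenhaus_zero]; exact isOpen_univ
  | succ n ih =>
    rcases n with _ | n
    · rw [zassenhaus_one]; exact isOpen_univ
    set D := zassenhaus p (freeSigmaProP p m).carrier (n + 1) with hD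
    set K := zassenhaus p (freeSigmaProP p m).carrier (n + 2) with hK
    have hKD : K ≤ D := zassenhaus_antitone p _ (Nat.le_succ _)
    have hDfin : D.FiniteIndex := by
      have : DiscreteTopology ((freeSigmaProP p m).carrier ⧸ D) :=
        QuotientGroup.discreteTopology ih
      have : Finite ((freeSigmaProP p m).carrier ⧸ D) := finite_of_compact_of_discrete
      exact Subgroup.finiteIndex_of_finite_quotient
    let Q := ((freeSigmaProP p m).modD (n + 2)).carrier
    let q : (freeSigmaProP p m).carrier →* Q := (freeSigmaProP p m).modDMk (n + 2)
    have hqc : Continuous q := (freeSigmaProP p m).continuous_modDMk (n + 2)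
    have hqk : q.ker = K := (freeSigmaProP p m).ker_modDMk (n + 2)
    let S : Subgroup (FreeGroup (Fin m)) := D.comap (of p)
    have hSfin : S.FiniteIndex := ⟨by
      rw [Subgroup.index_comap]
      exact mt Subgroup.index_eq_zero_of_relIndex_eq_zero hDfin.index_ne_zero⟩
    have hSfg : Group.FG S := inferInstance
    let A : Subgroup Q := S.map (q.comp (of p))
    have hAD : ∀ y ∈ A, ∃ x ∈ D, q x = y := by
      rintro _ ⟨w, hw, rfl⟩
      exact ⟨of p w, hw, rfl⟩
    have hAcomm : ∀ y z : A, y * z = z * y := by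
      rintro ⟨y, hy⟩ ⟨z, hz⟩
      obtain ⟨x, hx, rfl⟩ := hAD y hy
      obtain ⟨x', hx', rfl⟩ := hAD z hz
      apply Subtype.ext
      change q x * q x' = q x' * q x
      rw [← commutatorElement_eq_one_iff_mul_comm, ← map_commutatorElement, ← MonoidHom.mem_ker,
        hqk]
      refine commutator_le_zassenhaus p n 0 (Subgroup.commutator_mem_commutator hx ?_)
      rw [zassenhaus_one]; trivial
    have hApow : ∀ y : A, y ^ p = 1 := by
      rintro ⟨y, hy⟩
      obtain ⟨x, hx, rfl⟩ := hAD y hy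
      apply Subtype.ext
      change q x ^ p = 1
      rw [← map_pow, ← MonoidHom.mem_ker, hqk]
      exact pow_mem_zassenhaus_succ p hx
    have hAfin : Finite A := by
      let _ : CommGroup A := { (inferInstance : Group A) with mul_comm := hAcomm }
      have hAfg : Group.FG A := Group.fg_of_surjective ((q.comp (of p)).subgroupMap_surjective S)
      exact CommGroup.finite_of_fg_isMulTorsion A fun y =>
        isOfFinOrder_iff_pow_eq_one.2 ⟨p, hp.out.pos, hApow y⟩
    have hAcl : IsClosed (A : Set Q) := (Set.toFinite (A : Set Q)).isClosed
    have hDA : D.map q ≤ A := by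
      rintro _ ⟨x, hx, rfl⟩
      have h1 : x ∈ closure ((D : Set (freeSigmaProP p m).carrier) ∩ Set.range (of p)) :=
        denseRange_of.open_subset_closure_inter ih hx
      have h2 := map_mem_closure (t := (A : Set Q)) hqc h1 (by
        rintro _ ⟨hw, w, rfl⟩
        exact ⟨w, hw, rfl⟩)
      rwa [hAcl.closure_eq] at h2
    have hrel : K.relIndex D ≠ 0 := by
      have h3 : Finite (D.map q) := Finite.Set.subset (A : Set Q) hDA
      rw [← hqk, Subgroup.relIndex_ker]
      exact Nat.card_pos.ne'
    have hKfin : K.FiniteIndex := ⟨by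
      rw [← Subgroup.relIndex_mul_index hKD]
      exact mul_ne_zero hrel hDfin.index_ne_zero⟩
    exact K.isOpen_of_isClosed_of_finiteIndex (zassenhaus_isClosed p _ _)

theorem relSubgroup_le {r : Fin m → (freeSigmaProP p m).Odd}
    {N : Subgroup (freeSigmaProP p m).carrier} [N.Normal]
    (hN : IsClosed (N : Set (freeSigmaProP p m).carrier)) (h : ∀ j, (r j).1 ∈ N) :
    relSubgroup p r ≤ N := by
  refine Subgroup.topologicalClosure_minimal _ (Subgroup.normalClosure_le_normal ?_) hN
  rintro _ ⟨j, rfl⟩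
  exact h j

theorem mem_relSubgroup (r : Fin m → (freeSigmaProP p m).Odd) (j : Fin m) :
    (r j).1 ∈ relSubgroup p r :=
  Subgroup.le_topologicalClosure _ (Subgroup.subset_normalClosure ⟨j, rfl⟩)

/-- The projection from `Fₘ` to `G_r`. -/
def relMk (r : Fin m → (freeSigmaProP p m).Odd) :
    (freeSigmaProP p m).carrier →* (relGroup p r).carrier :=
  (freeSigmaProP p m).quotMk (relSubgroup p r) (relSubgroup_normal p r)
    (Subgroup.isClosed_topologicalClosure _) (relSubgroup_sigma p r)

theorem continuous_relMk (r : Fin m → (freeSigmaProP p m).Odd) : Continuous (relMk r) :=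
  SigmaProP.continuous_quotMk _ _ _ _ _

theorem relMk_surjective (r : Fin m → (freeSigmaProP p m).Odd) : Function.Surjective (relMk r) :=
  SigmaProP.quotMk_surjective _ _ _ _ _

theorem ker_relMk (r : Fin m → (freeSigmaProP p m).Odd) : (relMk r).ker = relSubgroup p r :=
  SigmaProP.ker_quotMk _ _ _ _ _

theorem relMk_σ (r : Fin m → (freeSigmaProP p m).Odd) (x : (freeSigmaProP p m).carrier) :
    relMk r ((freeSigmaProP p m).σ x) = (relGroup p r).σ (relMk r x) := rfl

theorem ker_modDMk_relMk_le {r s : Fin m → (freeSigmaProP p m).Odd} {i : ℕ}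
    (h : ∀ j, (r j).1⁻¹ * (s j).1 ∈ zassenhaus p (freeSigmaProP p m).carrier i) :
    (((relGroup p r).modDMk i).comp (relMk r)).ker ≤
      (((relGroup p s).modDMk i).comp (relMk s)).ker := by
  set f := ((relGroup p s).modDMk i).comp (relMk s)
  have hf : Continuous f := continuous_comp ((relGroup p s).continuous_modDMk i) (continuous_relMk s)
  have h1 : zassenhaus p (freeSigmaProP p m).carrier i ≤ f.ker := by
    intro y hy
    rw [MonoidHom.mem_ker, MonoidHom.comp_apply, ← MonoidHom.mem_ker, SigmaProP.ker_modDMk]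
    exact zassenhaus_map_le p (relMk s) (continuous_relMk s) i ⟨y, hy, rfl⟩
  have h2 : relSubgroup p r ≤ f.ker := by
    refine relSubgroup_le (isClosed_singleton.preimage hf) fun j => ?_
    have h3 : (s j).1 ∈ f.ker := by
      rw [MonoidHom.mem_ker, MonoidHom.comp_apply,
        MonoidHom.mem_ker.1 (show (s j).1 ∈ (relMk s).ker from ker_relMk s ▸ mem_relSubgroup s j),
        map_one]
    have h4 := mul_mem h3 (inv_mem (h1 (h j)))
    rwa [mul_inv_rev, inv_inv, mul_inv_cancel_left] at h4
  intro x hx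
  rw [MonoidHom.mem_ker, MonoidHom.comp_apply, ← MonoidHom.mem_ker, SigmaProP.ker_modDMk] at hx
  obtain ⟨y, hy, hxy⟩ := zassenhaus_le_map p (relMk r) (continuous_relMk r) (relMk_surjective r) i hx
  have h5 : y⁻¹ * x ∈ relSubgroup p r := by
    rw [← ker_relMk, MonoidHom.mem_ker, map_mul, map_inv, hxy, inv_mul_cancel]
  have h6 := mul_mem (h1 hy) (h2 h5)
  rwa [mul_inv_cancel_left] at h6

/-- The quotient `G_r / Dᵢ(G_r)` depends only on the relations modulo `Dᵢ`. -/
theorem modD_iso_of_congr {r s : Fin m → (freeSigmaProP p m).Odd} {i : ℕ}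
    (h : ∀ j, (r j).1⁻¹ * (s j).1 ∈ zassenhaus p (freeSigmaProP p m).carrier i) :
    ((relGroup p r).modD i).Iso ((relGroup p s).modD i) := by
  refine SigmaProP.Iso.of_ker_eq (freeSigmaProP p m).σ
    (((relGroup p r).modDMk i).comp (relMk r)) (((relGroup p s).modDMk i).comp (relMk s))
    (continuous_comp ((relGroup p r).continuous_modDMk i) (continuous_relMk r))
    (continuous_comp ((relGroup p s).continuous_modDMk i) (continuous_relMk s))
    (((relGroup p r).modDMk_surjective i).comp (relMk_surjective r))
    (((relGroup p s).modDMk_surjective i).comp (relMk_surjective s))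
    (fun _ => rfl) (fun _ => rfl) ?_
  refine le_antisymm (ker_modDMk_relMk_le h) (ker_modDMk_relMk_le fun j => ?_)
  have := inv_mem (h j)
  rwa [mul_inv_rev, inv_inv] at this

theorem continuous_theta : Continuous (theta p n) := by
  refine continuous_generateFrom_iff.2 ?_
  rintro _ ⟨i, k, t, -, rfl⟩
  rw [isOpen_iff_mem_nhds]
  rintro r ⟨k', r', hr, hiso⟩
  have hrr : (relGroup p r).Iso (relGroup p r') := Quotient.exact hr
  have hopen : IsOpen {s : Fin n → (freeSigmaProP p n).Odd |
      ∀ j, (r j).1⁻¹ * (s j).1 ∈ zassenhaus p (freeSigmaProP p n).carrier i} := by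
    rw [Set.ofPred_forall]
    refine isOpen_iInter_of_finite fun j => ?_
    refine (isOpen_zassenhaus i).preimage (continuous_const.mul ?_)
    exact continuous_subtype_val.comp (continuous_apply j)
  refine Filter.mem_of_superset (hopen.mem_nhds fun j => ?_) fun s hs => ?_
  · rw [inv_mul_cancel]; exact one_mem _
  · exact ⟨n, s, rfl, ((modD_iso_of_congr hs).symm.trans (hrr.modD i)).trans hiso⟩

theorem measurable_theta : Measurable (theta p n) := continuous_theta.measurable

/-- If one of the relations is part of a basis, it may be used to eliminate a generator. -/
theorem theta_eq_of_reduction {i : Fin (m + 1)} {r : Fin (m + 1) → (freeSigmaProP p (m + 1)).Odd}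
    {s : Fin m → (freeSigmaProP p m).Odd}
    (π : (freeSigmaProP p (m + 1)).carrier →* (freeSigmaProP p m).carrier)
    (hπ : Continuous π) (hπs : Function.Surjective π)
    (hπσ : ∀ x, π ((freeSigmaProP p (m + 1)).σ x) = (freeSigmaProP p m).σ (π x))
    (hi : π (r i).1 = 1) (hker : π.ker ≤ closedNormalClosure (r i).1)
    (hs : ∀ j, π (r (i.succAbove j)).1 = (s j).1) : theta p (m + 1) r = theta p m s := by
  refine Quotient.sound (SigmaProP.Iso.of_ker_eq (freeSigmaProP p (m + 1)).σ (relMk r)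
    ((relMk s).comp π) (continuous_relMk r) (continuous_comp (continuous_relMk s) hπ)
    (relMk_surjective r) ((relMk_surjective s).comp hπs) (fun _ => rfl)
    (fun x => by rw [MonoidHom.comp_apply, hπσ, relMk_σ]; rfl) ?_)
  have hN := relSubgroup_normal p r
  rw [← MonoidHom.comap_ker, ker_relMk, ker_relMk]
  have hker' : π.ker ≤ relSubgroup p r := hker.trans
    (closedNormalClosure_le (Subgroup.isClosed_topologicalClosure _) (mem_relSubgroup r i))
  apply le_antisymm
  · have := relSubgroup_normal p s
    refine relSubgroup_le ((Subgroup.isClosed_topologicalClosure _).preimage hπ) fun j => ?_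
    rw [Subgroup.mem_comap]
    rcases Fin.eq_self_or_eq_succAbove i j with rfl | ⟨j, rfl⟩
    · rw [hi]; exact one_mem _
    · rw [hs]; exact mem_relSubgroup s j
  · have h1 : ((relSubgroup p r).map π).Normal := hN.map π hπs
    have h2 : relSubgroup p s ≤ (relSubgroup p r).map π := by
      refine relSubgroup_le ?_ fun j => ⟨_, mem_relSubgroup r (i.succAbove j), hs j⟩
      exact ((Subgroup.isClosed_topologicalClosure _).isCompact.image hπ).isClosed
    intro x hx
    obtain ⟨y, hy, hxy⟩ := h2 hx
    have h3 : y⁻¹ * x ∈ π.ker := by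
      rw [MonoidHom.mem_ker, map_mul, map_inv, hxy, inv_mul_cancel]
    have h4 := mul_mem hy (hker' h3)
    rwa [mul_inv_cancel_left] at h4

end FreeProP

/-! ### Haar measures on `Fₘ`, on its Frattini subgroup, and on their odd parts -/

namespace SigmaProP

variable {p : ℕ} (G : SigmaProP p)

instance : IsProbabilityMeasure G.haar := ⟨G.haar_univ⟩

instance : G.haar.IsHaarMeasure := inferInstanceAs (Measure.haarMeasure _).IsHaarMeasure

instance : IsProbabilityMeasure G.oddHaar := ⟨G.oddHaar_univ⟩

variable {G}

theorem map_haar {H : SigmaProP p} {f : G.carrier →* H.carrier} (hf : Continuous f)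
    (hs : Function.Surjective f) : G.haar.map f = H.haar := by
  have := Measure.isHaarMeasure_map_of_isFiniteMeasure G.haar f hf hs
  have := Measure.isProbabilityMeasure_map (μ := G.haar) hf.measurable.aemeasurable
  exact Measure.isHaarMeasure_eq_of_isProbabilityMeasure _ _

/-- The map `G⁻ → H⁻` induced by a `σ`-equivariant homomorphism `G → H`. -/
def mapOdd {H : SigmaProP p} (f : G.carrier →* H.carrier) (hσ : ∀ x, f (G.σ x) = H.σ (f x))
    (a : G.Odd) : H.Odd :=
  ⟨f a.1, by rw [← hσ, a.2, map_inv]⟩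

theorem continuous_mapOdd {H : SigmaProP p} {f : G.carrier →* H.carrier} (hf : Continuous f)
    (hσ : ∀ x, f (G.σ x) = H.σ (f x)) : Continuous (mapOdd f hσ) :=
  Continuous.subtype_mk (hf.comp continuous_subtype_val) _

theorem mapOdd_toOdd {H : SigmaProP p} (f : G.carrier →* H.carrier)
    (hσ : ∀ x, f (G.σ x) = H.σ (f x)) (g : G.carrier) :
    mapOdd f hσ (G.toOdd g) = H.toOdd (f g) :=
  Subtype.ext (by simp [mapOdd, toOdd, hσ])

theorem map_map_toOdd {H : SigmaProP p} {f : G.carrier →* H.carrier} (hf : Continuous f)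
    (hσ : ∀ x, f (G.σ x) = H.σ (f x)) (μ : Measure G.carrier) :
    (μ.map G.toOdd).map (mapOdd f hσ) = (μ.map f).map H.toOdd := by
  rw [Measure.map_map (continuous_mapOdd hf hσ).measurable G.continuous_toOdd.measurable,
    Measure.map_map H.continuous_toOdd.measurable hf.measurable]
  congr 1
  ext1 g
  exact mapOdd_toOdd f hσ g

theorem map_oddHaar {H : SigmaProP p} {f : G.carrier →* H.carrier} (hf : Continuous f)
    (hs : Function.Surjective f) (hσ : ∀ x, f (G.σ x) = H.σ (f x)) :
    G.oddHaar.map (mapOdd f hσ) = H.oddHaar := by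
  rw [oddHaar, map_map_toOdd hf, map_haar hf hs, oddHaar]

end SigmaProP

namespace FreeProP

variable {p : ℕ} [hp : Fact p.Prime] {m n : ℕ}

theorem measurableSet_zassenhaus (n : ℕ) :
    MeasurableSet (zassenhaus p (freeSigmaProP p m).carrier n : Set (freeSigmaProP p m).carrier) :=
  (isOpen_zassenhaus n).measurableSet

theorem haar_zassenhaus_two :
    (freeSigmaProP p m).haar (zassenhaus p (freeSigmaProP p m).carrier 2) = ((p : ℝ≥0∞) ^ m)⁻¹ := by
  have : (zassenhaus p (freeSigmaProP p m).carrier 2).FiniteIndex :=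
    ⟨by rw [index_zassenhaus_two]; exact pow_ne_zero _ hp.out.ne_zero⟩
  have h := Subgroup.index_mul_measure (zassenhaus p (freeSigmaProP p m).carrier 2)
    (measurableSet_zassenhaus 2) (freeSigmaProP p m).haar
  rw [index_zassenhaus_two, measure_univ, Nat.cast_pow, mul_comm] at h
  exact ENNReal.eq_inv_of_mul_eq_one_left h

variable (p m) in
/-- The Haar measure of total mass one of the Frattini subgroup `D₂(Fₘ)`, as a measure on `Fₘ`. -/
noncomputable def frattiniHaar : Measure (freeSigmaProP p m).carrier :=
  ((p : ℝ≥0∞) ^ m) • (freeSigmaProP p m).haar.restrict (zassenhaus p (freeSigmaProP p m).carrier 2)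

theorem natCast_pow_ne_zero : ((p : ℝ≥0∞) ^ m) ≠ 0 :=
  pow_ne_zero _ (Nat.cast_ne_zero.2 hp.out.ne_zero)

omit hp in
theorem natCast_pow_ne_top : ((p : ℝ≥0∞) ^ m) ≠ ∞ :=
  ENNReal.pow_ne_top (ENNReal.natCast_ne_top p)

instance : IsProbabilityMeasure (frattiniHaar p m) := ⟨by
  rw [frattiniHaar, Measure.smul_apply, Measure.restrict_apply_univ, haar_zassenhaus_two,
    smul_eq_mul, ENNReal.mul_inv_cancel natCast_pow_ne_zero natCast_pow_ne_top]⟩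

variable (p m) in
/-- The Haar measure of total mass one of the Frattini subgroup, on the subgroup itself. -/
noncomputable def frattiniHaarSubtype : Measure (zassenhaus p (freeSigmaProP p m).carrier 2) :=
  ((p : ℝ≥0∞) ^ m) • (freeSigmaProP p m).haar.comap Subtype.val

theorem map_frattiniHaarSubtype :
    (frattiniHaarSubtype p m).map Subtype.val = frattiniHaar p m := by
  rw [frattiniHaarSubtype, Measure.map_smul, frattiniHaar]
  congr 1
  exact map_comap_subtype_coe (measurableSet_zassenhaus 2) _

instance : IsProbabilityMeasure (frattiniHaarSubtype p m) := ⟨by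
  have h := measure_univ (μ := frattiniHaar p m)
  rwa [← map_frattiniHaarSubtype, Measure.map_apply measurable_subtype_coe MeasurableSet.univ] at h⟩

instance : (frattiniHaarSubtype p m).IsHaarMeasure := by
  have h : ((freeSigmaProP p m).haar.comap
      (Subtype.val : zassenhaus p (freeSigmaProP p m).carrier 2 → _)).IsHaarMeasure :=
    Measure.IsHaarMeasure.comap (mH := inferInstance) _
      (f := (zassenhaus p (freeSigmaProP p m).carrier 2).subtype)
      (isOpen_zassenhaus 2).isOpenEmbedding_subtypeVal
  exact Measure.IsHaarMeasure.smul _ natCast_pow_ne_zero natCast_pow_ne_top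

/-- A surjection between free pro-`p`-groups maps the Frattini subgroup onto the Frattini
subgroup, and hence its Haar measure to the Haar measure. -/
theorem map_frattiniHaar {f : (freeSigmaProP p m).carrier →* (freeSigmaProP p n).carrier}
    (hf : Continuous f) (hs : Function.Surjective f) :
    (frattiniHaar p m).map f = frattiniHaar p n := by
  have hle := zassenhaus_map_le p f hf 2
  have hge := zassenhaus_le_map p f hf hs 2
  let g : zassenhaus p (freeSigmaProP p m).carrier 2 →* zassenhaus p (freeSigmaProP p n).carrier 2 :=
    (f.comp (Subgroup.subtype _)).codRestrict _ fun x => hle ⟨x.1, x.2, rfl⟩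
  have hg : Continuous g := Continuous.subtype_mk (hf.comp continuous_subtype_val) _
  have hgs : Function.Surjective g := by
    rintro ⟨y, hy⟩
    obtain ⟨x, hx, hxy⟩ := hge hy
    exact ⟨⟨x, hx⟩, Subtype.ext hxy⟩
  have h1 : (frattiniHaarSubtype p m).map g = frattiniHaarSubtype p n := by
    have := Measure.isHaarMeasure_map_of_isFiniteMeasure (frattiniHaarSubtype p m) g hg hgs
    have := Measure.isProbabilityMeasure_map (μ := frattiniHaarSubtype p m)
      hg.measurable.aemeasurable
    have : CompactSpace (zassenhaus p (freeSigmaProP p n).carrier 2) :=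
      isCompact_iff_compactSpace.1 (zassenhaus_isClosed p _ 2).isCompact
    exact Measure.isHaarMeasure_eq_of_isProbabilityMeasure _ _
  rw [← map_frattiniHaarSubtype, ← map_frattiniHaarSubtype, ← h1,
    Measure.map_map measurable_subtype_coe hg.measurable,
    Measure.map_map hf.measurable measurable_subtype_coe]
  rfl

variable (p m) in
/-- The Haar measure on the odd part of the Frattini subgroup. -/
noncomputable def frattiniOdd : Measure (freeSigmaProP p m).Odd :=
  (frattiniHaar p m).map (freeSigmaProP p m).toOdd

instance : IsProbabilityMeasure (frattiniOdd p m) :=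
  Measure.isProbabilityMeasure_map (freeSigmaProP p m).continuous_toOdd.measurable.aemeasurable

theorem map_frattiniOdd {f : (freeSigmaProP p m).carrier →* (freeSigmaProP p n).carrier}
    (hf : Continuous f) (hs : Function.Surjective f)
    (hσ : ∀ x, f ((freeSigmaProP p m).σ x) = (freeSigmaProP p n).σ (f x)) :
    (frattiniOdd p m).map (SigmaProP.mapOdd f hσ) = frattiniOdd p n := by
  rw [frattiniOdd, SigmaProP.map_map_toOdd hf, map_frattiniHaar hf hs, frattiniOdd]

variable (p m) in
/-- The set of odd elements of the Frattini subgroup. -/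
def frattiniSet : Set (freeSigmaProP p m).Odd :=
  {b | b.1 ∈ zassenhaus p (freeSigmaProP p m).carrier 2}

theorem measurableSet_frattiniSet : MeasurableSet (frattiniSet p m) :=
  IsOpen.measurableSet (α := (freeSigmaProP p m).Odd)
    ((isOpen_zassenhaus 2).preimage continuous_subtype_val)

/-- On the Frattini quotient, `g ↦ g σ(g)⁻¹` is squaring, which is injective as `p` is odd. -/
theorem preimage_toOdd_frattiniSet (hp2 : p ≠ 2) :
    (freeSigmaProP p m).toOdd ⁻¹' frattiniSet p m =
      zassenhaus p (freeSigmaProP p m).carrier 2 := by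
  have hσ : ∀ g, coord p m ((freeSigmaProP p m).σ g) = (coord p m g)⁻¹ := by
    let _ : TopologicalSpace (Fin m → Multiplicative (ZMod p)) := ⊥
    have : DiscreteTopology (Fin m → Multiplicative (ZMod p)) := ⟨rfl⟩
    have hc : Continuous (coord p m) := (exists_coord p m).choose_spec.2 ⊥
    have hi : (coord p m).comp (freeSigmaProP p m).σ.toMonoidHom =
        (invMonoidHom : (Fin m → Multiplicative (ZMod p)) →* _).comp (coord p m) := by
      refine hom_ext (continuous_comp hc (freeSigmaProP p m).σ.continuous_toFun)
        (continuous_comp (continuous_of_discreteTopology (f := invMonoidHom)) hc) fun i => ?_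
      change coord p m ((freeSigmaProP p m).σ (gen p i)) = (coord p m (gen p i))⁻¹
      rw [σ_gen, map_inv]
    exact fun g => DFunLike.congr_fun hi g
  ext g
  change g * ((freeSigmaProP p m).σ g)⁻¹ ∈ zassenhaus p (freeSigmaProP p m).carrier 2 ↔
    g ∈ zassenhaus p (freeSigmaProP p m).carrier 2
  rw [zassenhaus_two_eq_ker_coord, MonoidHom.mem_ker, MonoidHom.mem_ker, map_mul, map_inv, hσ,
    inv_inv]
  refine ⟨fun h => ?_, fun h => by rw [h, one_mul]⟩
  obtain ⟨l, hl⟩ : Odd p := hp.out.odd_of_ne_two hp2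
  have h1 : coord p m g ^ (2 * l + 1) = 1 := (congrArg _ hl.symm).trans (pow_pi_zmod _)
  rwa [pow_succ, pow_mul, pow_two, h, one_pow, one_mul] at h1

theorem restrict_oddHaar (hp2 : p ≠ 2) :
    (freeSigmaProP p m).oddHaar.restrict (frattiniSet p m) =
      ((p : ℝ≥0∞) ^ m)⁻¹ • frattiniOdd p m := by
  rw [SigmaProP.oddHaar, Measure.restrict_map (freeSigmaProP p m).continuous_toOdd.measurable
    measurableSet_frattiniSet, preimage_toOdd_frattiniSet hp2, frattiniOdd, frattiniHaar,
    Measure.map_smul, smul_smul, ENNReal.inv_mul_cancel natCast_pow_ne_zero natCast_pow_ne_top,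
    one_smul]

theorem oddHaar_frattiniSet (hp2 : p ≠ 2) :
    (freeSigmaProP p m).oddHaar (frattiniSet p m) = ((p : ℝ≥0∞) ^ m)⁻¹ := by
  have h := congrArg (fun μ => μ Set.univ) (restrict_oddHaar (p := p) (m := m) hp2)
  simpa using h

theorem frattiniOdd_frattiniSet (hp2 : p ≠ 2) : frattiniOdd p m (frattiniSet p m) = 1 := by
  rw [frattiniOdd, Measure.map_apply (freeSigmaProP p m).continuous_toOdd.measurable
    measurableSet_frattiniSet, preimage_toOdd_frattiniSet hp2, frattiniHaar, Measure.smul_apply,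
    Measure.restrict_apply_self, haar_zassenhaus_two, smul_eq_mul,
    ENNReal.mul_inv_cancel natCast_pow_ne_zero natCast_pow_ne_top]

/-! ### Eliminating one relation -/

variable (p m) in
/-- The law of an `m`-tuple of independent relations in `Fₘ`, of which the first `k` are Haar
distributed in `Fₘ⁻` and the others in the odd part of the Frattini subgroup. -/
noncomputable def relLaw (k : ℕ) (i : Fin m) : Measure (freeSigmaProP p m).Odd :=
  if i.1 < k then (freeSigmaProP p m).oddHaar else frattiniOdd p m

instance (k : ℕ) (i : Fin m) : IsProbabilityMeasure (relLaw p m k i) := by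
  rw [relLaw]
  split_ifs <;> infer_instance

variable (p m) in
/-- The law of `[G_r]` if `r` has the distribution `relLaw p m k`. -/
noncomputable def mixedMu (k : ℕ) : Measure (Sch p) :=
  (Measure.pi (relLaw p m k)).map (theta p m)

instance (k : ℕ) : IsProbabilityMeasure (mixedMu p m k) :=
  Measure.isProbabilityMeasure_map measurable_theta.aemeasurable

theorem mixedMu_self : mixedMu p m m = mu p m := by
  have : relLaw p m m = fun _ => (freeSigmaProP p m).oddHaar := by
    ext1 i
    rw [relLaw, if_pos i.2]
  rw [mixedMu, mu, this]

theorem succAbove_lt_iff {k : ℕ} (hk : k ≤ m) (j : Fin m) :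
    ((⟨k, by omega⟩ : Fin (m + 1)).succAbove j).1 < k ↔ j.1 < k := by
  simp only [Fin.succAbove, Fin.lt_def, Fin.val_castSucc]
  split_ifs with h
  · rfl
  · rw [Fin.val_succ]
    omega

theorem succAbove_lt_succ_iff {k : ℕ} (hk : k ≤ m) (j : Fin m) :
    ((⟨k, by omega⟩ : Fin (m + 1)).succAbove j).1 < k + 1 ↔ j.1 < k := by
  simp only [Fin.succAbove, Fin.lt_def, Fin.val_castSucc]
  split_ifs with h
  · rw [Fin.val_castSucc]
    omega
  · rw [Fin.val_succ]
    omega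

theorem pi_apply_eq_lintegral (μ : Fin (m + 1) → Measure (freeSigmaProP p n).Odd)
    [∀ i, IsProbabilityMeasure (μ i)] (i : Fin (m + 1))
    {T : Set (Fin (m + 1) → (freeSigmaProP p n).Odd)} (hT : MeasurableSet T) :
    Measure.pi μ T = ∫⁻ a, Measure.pi (fun j => μ (i.succAbove j))
      {s | i.insertNth (α := fun _ => _) a s ∈ T} ∂(μ i) := by
  have h := (measurePreserving_piFinSuccAbove μ i).symm
  rw [← h.measure_preimage hT.nullMeasurableSet,
    Measure.prod_apply (h.measurable hT)]
  rfl

/-- Conditioning on the last of the arbitrary relations: it lies in the Frattini subgroup with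
probability `p⁻⁽ᵐ⁺¹⁾`, and otherwise it eliminates a generator. -/
theorem mixedMu_succ (hp2 : p ≠ 2) {k : ℕ} (hk : k ≤ m) {A : Set (Sch p)} (hA : MeasurableSet A) :
    mixedMu p (m + 1) (k + 1) A = ((p : ℝ≥0∞) ^ (m + 1))⁻¹ * mixedMu p (m + 1) k A +
      (1 - ((p : ℝ≥0∞) ^ (m + 1))⁻¹) * mixedMu p m k A := by
  set i : Fin (m + 1) := ⟨k, by omega⟩ with hi
  have hT := measurable_theta (p := p) (n := m + 1) hA
  set ρ : Fin m → Measure (freeSigmaProP p (m + 1)).Odd := fun j =>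
    if j.1 < k then (freeSigmaProP p (m + 1)).oddHaar else frattiniOdd p (m + 1) with hρ
  have h1 : (fun j => relLaw p (m + 1) (k + 1) (i.succAbove j)) = ρ := by
    ext1 j
    simp only [relLaw, hρ, hi, succAbove_lt_succ_iff hk]
  have h2 : (fun j => relLaw p (m + 1) k (i.succAbove j)) = ρ := by
    ext1 j
    simp only [relLaw, hρ, hi, succAbove_lt_iff hk]
  have h3 : relLaw p (m + 1) (k + 1) i = (freeSigmaProP p (m + 1)).oddHaar :=
    if_pos (Nat.lt_succ_self k)
  have h4 : relLaw p (m + 1) k i = frattiniOdd p (m + 1) := if_neg (lt_irrefl k)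
  rw [mixedMu, mixedMu, Measure.map_apply measurable_theta hA, Measure.map_apply measurable_theta hA,
    pi_apply_eq_lintegral _ i hT, pi_apply_eq_lintegral _ i hT, h1, h2, h3, h4]
  set g : (freeSigmaProP p (m + 1)).Odd → ℝ≥0∞ := fun a => Measure.pi ρ
    {s | i.insertNth (α := fun _ => _) a s ∈ theta p (m + 1) ⁻¹' A}
  -- Outside the Frattini subgroup the inner probability is constant: the reduction along `a` maps
  -- the law `ρ` of the remaining relations to `relLaw p m k`, whatever `a` is.
  have hg : ∀ a ∈ (frattiniSet p (m + 1))ᶜ, g a = mixedMu p m k A := by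
    intro a ha
    obtain ⟨π, hπ, hπs, hπσ, hπa, hπk⟩ := exists_reduction a ha
    have hpres : MeasurePreserving
        (fun (s : Fin m → (freeSigmaProP p (m + 1)).Odd) j => SigmaProP.mapOdd π hπσ (s j))
        (Measure.pi ρ) (Measure.pi (relLaw p m k)) := by
      refine measurePreserving_pi ρ (relLaw p m k) (f := fun _ => SigmaProP.mapOdd π hπσ) fun j =>
        ⟨(SigmaProP.continuous_mapOdd hπ hπσ).measurable, ?_⟩
      simp only [hρ, relLaw]
      split_ifs
      · exact SigmaProP.map_oddHaar hπ hπs hπσ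
      · exact map_frattiniOdd hπ hπs hπσ
    rw [mixedMu, Measure.map_apply measurable_theta hA,
      ← hpres.measure_preimage (measurable_theta hA).nullMeasurableSet]
    refine congrArg _ (Set.ext fun s => ?_)
    change theta p (m + 1) (i.insertNth (α := fun _ => _) a s) ∈ A ↔
      theta p m (fun j => SigmaProP.mapOdd π hπσ (s j)) ∈ A
    rw [theta_eq_of_reduction (i := i) (s := fun j => SigmaProP.mapOdd π hπσ (s j)) π hπ hπs hπσ
      (by rwa [Fin.insertNth_apply_same]) (by rwa [Fin.insertNth_apply_same])
      (fun j => by rw [Fin.insertNth_apply_succAbove]; rfl)]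
  change ∫⁻ a, g a ∂_ = _ * ∫⁻ a, g a ∂_ + _
  rw [← lintegral_add_compl g (measurableSet_frattiniSet (p := p) (m := m + 1)),
    restrict_oddHaar hp2, lintegral_smul_measure, smul_eq_mul,
    setLIntegral_congr_fun measurableSet_frattiniSet.compl hg, setLIntegral_const,
    prob_compl_eq_one_sub measurableSet_frattiniSet, oddHaar_frattiniSet hp2, mul_comm _ (1 - _)]

end FreeProP

/-! ### The minimal number of generators -/

namespace SigmaProP

variable {p : ℕ} [hp : Fact p.Prime]

omit hp in
theorem topologicalClosure_closure_map {A B : SigmaProP p} {f : A.carrier →* B.carrier}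
    (hf : Continuous f) (hs : Function.Surjective f) {k : ℕ} {s : Fin k → A.carrier}
    (h : (Subgroup.closure (Set.range s)).topologicalClosure = ⊤) :
    (Subgroup.closure (Set.range (f ∘ s))).topologicalClosure = ⊤ := by
  rw [Subgroup.eq_top_iff']
  intro y
  obtain ⟨x, rfl⟩ := hs y
  have hx : x ∈ (Subgroup.closure (Set.range s)).topologicalClosure := h ▸ Subgroup.mem_top x
  refine map_mem_closure hf hx fun z hz => ?_
  rw [Set.range_comp, ← MonoidHom.map_closure]
  exact ⟨z, hz, rfl⟩

/-- The number of generators does not change in a quotient by a subgroup of `D₂`. -/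
theorem numGens_eq_of_ker_le {A B : SigmaProP p} (f : A.carrier →* B.carrier)
    (hf : Continuous f) (hs : Function.Surjective f) (hker : f.ker ≤ zassenhaus p A.carrier 2) :
    A.numGens = B.numGens := by
  rw [numGens, numGens]
  congr 1
  ext k
  constructor
  · rintro ⟨s, hsA⟩
    exact ⟨f ∘ s, topologicalClosure_closure_map hf hs hsA⟩
  · rintro ⟨t, ht⟩
    choose s hst using fun j => hs (t j)
    refine ⟨s, A.eq_top_of_sup_zassenhaus_two _ (Subgroup.isClosed_topologicalClosure _) ?_⟩
    set H := (Subgroup.closure (Set.range s)).topologicalClosure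
    have hmap : H.map f = ⊤ := by
      rw [← top_le_iff, ← ht]
      refine Subgroup.topologicalClosure_minimal _ ?_
        ((Subgroup.isClosed_topologicalClosure _).isCompact.image hf).isClosed
      rw [Subgroup.closure_le]
      rintro _ ⟨j, rfl⟩
      exact ⟨s j, Subgroup.le_topologicalClosure _ (Subgroup.subset_closure ⟨j, rfl⟩), hst j⟩
    rw [← top_le_iff, ← Subgroup.comap_top f, ← hmap, Subgroup.comap_map_eq]
    exact sup_le_sup_left hker H

theorem Iso.numGens_eq {A B : SigmaProP p} (h : A.Iso B) : A.numGens = B.numGens := by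
  obtain ⟨e, -⟩ := h
  refine numGens_eq_of_ker_le e.toMulEquiv.toMonoidHom e.continuous_toFun e.surjective ?_
  rw [(MonoidHom.ker_eq_bot_iff _).2 e.injective]
  exact bot_le

end SigmaProP

namespace FreeProP

variable {p : ℕ} [hp : Fact p.Prime] {m n : ℕ}

theorem topologicalClosure_closure_gen :
    (Subgroup.closure (Set.range (gen p (m := m)))).topologicalClosure = ⊤ := by
  have h : Subgroup.closure (Set.range (gen p (m := m))) = (of p).range := by
    rw [MonoidHom.range_eq_map, ← FreeGroup.closure_range_of, MonoidHom.map_closure,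
      ← Set.range_comp]
    rfl
  rw [h, Subgroup.eq_top_iff']
  exact fun x => denseRange_of x

theorem numGens_freeSigmaProP : (freeSigmaProP p m).numGens = m := by
  refine le_antisymm (Nat.sInf_le ⟨gen p, topologicalClosure_closure_gen⟩)
    (le_csInf ⟨m, gen p, topologicalClosure_closure_gen⟩ ?_)
  rintro k ⟨s, hs⟩
  obtain ⟨t, ht⟩ := exists_pi_zmod_hom (p := p) pow_pi_zmod fun j => coord p m (s j)
  have hsurj : Function.Surjective t := by
    intro v
    obtain ⟨x, rfl⟩ := coord_surjective (p := p) v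
    have hcl : IsClosed (t.range.comap (coord p m) : Set (freeSigmaProP p m).carrier) :=
      Subgroup.isClosed_of_isOpen _ (Subgroup.isOpen_mono (MonoidHom.ker_le_comap _ _)
        isOpen_ker_coord)
    have hle : (Subgroup.closure (Set.range s)).topologicalClosure ≤
        t.range.comap (coord p m) := by
      refine Subgroup.topologicalClosure_minimal _ ?_ hcl
      rw [Subgroup.closure_le]
      rintro _ ⟨j, rfl⟩
      exact ⟨_, ht j⟩
    exact hle (hs ▸ Subgroup.mem_top x)
  have hcard := Nat.card_le_card_of_surjective t hsurj
  rw [Nat.card_fun, Nat.card_fun, Nat.card_congr Multiplicative.toAdd, Nat.card_zmod,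
    Nat.card_fin, Nat.card_fin] at hcard
  exact (Nat.pow_le_pow_iff_right hp.out.one_lt).1 hcard

variable (p m) in
/-- The trivial relations. -/
def trivialRel (_ : Fin m) : (freeSigmaProP p m).Odd := ⟨1, by simp⟩

theorem numGens_modD_trivialRel : ((relGroup p (trivialRel p m)).modD 2).numGens = m := by
  rw [← SigmaProP.numGens_eq_of_ker_le (A := freeSigmaProP p m)
    (((relGroup p (trivialRel p m)).modDMk 2).comp (relMk _))
    (continuous_comp (SigmaProP.continuous_modDMk _ 2) (continuous_relMk _))
    ((SigmaProP.modDMk_surjective _ 2).comp (relMk_surjective _)), numGens_freeSigmaProP]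
  intro x hx
  rw [MonoidHom.mem_ker, MonoidHom.comp_apply, ← MonoidHom.mem_ker, SigmaProP.ker_modDMk] at hx
  obtain ⟨y, hy, hxy⟩ := zassenhaus_le_map p (relMk (trivialRel p m)) (continuous_relMk _)
    (relMk_surjective _) 2 hx
  have h1 : y⁻¹ * x ∈ relSubgroup p (trivialRel p m) := by
    rw [← ker_relMk, MonoidHom.mem_ker, map_mul, map_inv, hxy, inv_mul_cancel]
  have h2 : relSubgroup p (trivialRel p m) ≤ zassenhaus p (freeSigmaProP p m).carrier 2 := by
    have := zassenhaus_normal p (freeSigmaProP p m).carrier 2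
    exact relSubgroup_le (zassenhaus_isClosed p _ 2) fun j => one_mem _
  have h3 := mul_mem hy (h2 h1)
  rwa [mul_inv_cancel_left] at h3

variable (p m) in
/-- The basic open set of the classes `[G]` with `G / D₂(G)` isomorphic to `Fₘ / D₂(Fₘ)`. -/
def rankSet : Set (Sch p) := schBasic p 2 (relGroup p (trivialRel p m))

theorem measurableSet_rankSet : MeasurableSet (rankSet p m) :=
  IsOpen.measurableSet (α := Sch p)
    (TopologicalSpace.isOpen_generateFrom_of_mem ⟨2, m, trivialRel p m, le_rfl, rfl⟩)

theorem rankSet_subset_schGens : rankSet p m ⊆ schGens p m := by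
  rintro _ ⟨k, r, rfl, h⟩
  refine ⟨k, r, rfl, ?_⟩
  rw [SigmaProP.numGens_eq_of_ker_le _ ((relGroup p r).continuous_modDMk 2)
    ((relGroup p r).modDMk_surjective 2) (SigmaProP.ker_modDMk _ 2).le, h.numGens_eq,
    numGens_modD_trivialRel]

theorem eq_of_mem_schGens {x : Sch p} (hm : x ∈ schGens p m) (hn : x ∈ schGens p n) : m = n := by
  obtain ⟨k, r, rfl, rfl⟩ := hm
  obtain ⟨l, s, hs, rfl⟩ := hn
  exact SigmaProP.Iso.numGens_eq (Quotient.exact hs)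

/-- If all relations lie in the Frattini subgroup, no generator is redundant. -/
theorem mixedMu_zero_rankSet (hp2 : p ≠ 2) : mixedMu p m 0 (rankSet p m) = 1 := by
  refine le_antisymm prob_le_one ?_
  rw [mixedMu, Measure.map_apply measurable_theta measurableSet_rankSet]
  have hsub : Set.univ.pi (fun _ => frattiniSet p m) ⊆ theta p m ⁻¹' rankSet p m := by
    intro r hr
    refine ⟨m, r, rfl, modD_iso_of_congr fun j => ?_⟩
    exact mul_mem (inv_mem (hr j trivial)) (one_mem _)
  refine le_trans ?_ (measure_mono hsub)
  rw [Measure.pi_pi]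
  refine (Finset.prod_eq_one fun i _ => ?_).ge
  rw [relLaw, if_neg (Nat.not_lt_zero _), frattiniOdd_frattiniSet hp2]

theorem mixedMu_zero_schGens (hp2 : p ≠ 2) (m n : ℕ) :
    mixedMu p m 0 (schGens p n) = if m = n then 1 else 0 := by
  split_ifs with h
  · subst h
    exact le_antisymm prob_le_one
      ((mixedMu_zero_rankSet hp2).ge.trans (measure_mono rankSet_subset_schGens))
  · refine measure_mono_null (t := (rankSet p m)ᶜ) ?_ ?_
    · exact fun x hx hx' => h (eq_of_mem_schGens (rankSet_subset_schGens hx') hx)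
    · rw [prob_compl_eq_zero_iff measurableSet_rankSet, mixedMu_zero_rankSet hp2]

end FreeProP

/-! ### Solving the recursion -/

namespace FreeProP

section Constants

theorem constC_succ (p k : ℕ) :
    constC p (k + 1) = constC p k * (1 - ((p : ℝ) ^ (k + 1))⁻¹) :=
  Finset.prod_Icc_succ_top (by omega) _

variable {p : ℕ}

/-- The bound is stated so that it can be proved by induction. -/
theorem half_add_le_constC (hp : 3 ≤ p) (k : ℕ) : 1 / 2 + ((p : ℝ) ^ k)⁻¹ / 2 ≤ constC p k := by
  have hp' : (3 : ℝ) ≤ p := by exact_mod_cast hp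
  induction k with
  | zero => norm_num [constC]
  | succ k ih =>
    rw [constC_succ]
    set x := ((p : ℝ) ^ k)⁻¹ with hx
    have hx0 : 0 < x := by positivity
    have hx1 : x ≤ 1 := inv_le_one_of_one_le₀ (one_le_pow₀ (by linarith))
    have hy : ((p : ℝ) ^ (k + 1))⁻¹ = x * (p : ℝ)⁻¹ := by rw [pow_succ, mul_inv]
    rw [hy]
    have hq : (p : ℝ)⁻¹ ≤ 1 / 3 := by
      rw [one_div]; exact inv_anti₀ (by norm_num) hp'
    have hq0 : 0 < (p : ℝ)⁻¹ := by positivity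
    have h1 : 0 ≤ 1 - x * (p : ℝ)⁻¹ := by nlinarith
    refine le_trans ?_ (mul_le_mul_of_nonneg_right ih h1)
    nlinarith [mul_nonneg hx0.le hq0.le, mul_nonneg (mul_nonneg hx0.le hq0.le) (sub_nonneg.2 hx1)]

theorem half_le_constC (hp : 3 ≤ p) (k : ℕ) : 1 / 2 ≤ constC p k :=
  le_trans (le_add_of_nonneg_right (by positivity)) (half_add_le_constC hp k)

theorem constC_pos (hp : 3 ≤ p) (k : ℕ) : 0 < constC p k :=
  lt_of_lt_of_le (by norm_num) (half_le_constC hp k)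

theorem constC_le_one (hp : 3 ≤ p) (k : ℕ) : constC p k ≤ 1 := by
  induction k with
  | zero => simp [constC]
  | succ k ih =>
    rw [constC_succ]
    refine (mul_le_of_le_one_right (constC_pos hp k).le ?_).trans ih
    exact sub_le_self _ (by positivity)

theorem tendsto_constC (hp : 3 ≤ p) : Tendsto (constC p) atTop (𝓝 (constCInf p)) := by
  have hp' : (3 : ℝ) ≤ p := by exact_mod_cast hp
  have hm : Multipliable fun i : ℕ => (1 - ((p : ℝ) ^ (i + 1))⁻¹) := by
    have hs : Summable fun i : ℕ => ‖-((p : ℝ) ^ (i + 1))⁻¹‖ := by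
      have h1 : Summable fun i : ℕ => ((p : ℝ)⁻¹) ^ i :=
        summable_geometric_of_lt_one (by positivity) (inv_lt_one_of_one_lt₀ (by linarith))
      refine ((summable_nat_add_iff 1).2 h1).congr fun i => ?_
      rw [norm_neg, norm_inv, norm_pow, Real.norm_natCast, inv_pow]
    simpa [sub_eq_add_neg] using multipliable_one_add_of_summable hs
  refine hm.hasProd.tendsto_prod_nat.congr fun n => ?_
  rw [constC, Finset.range_eq_Ico, Finset.prod_Ico_add' (fun i => 1 - ((p : ℝ) ^ i)⁻¹) 0 n 1]
  rfl

theorem half_le_constCInf (hp : 3 ≤ p) : 1 / 2 ≤ constCInf p :=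
  ge_of_tendsto' (tendsto_constC hp) (half_le_constC hp)

variable (p) in
/-- The probability that a random `(k + l) × k`-matrix over `𝔽ₚ` has corank `l + t`, that is,
has rank `k - t`. -/
noncomputable def corankProb (k l t : ℕ) : ℝ :=
  if t ≤ k then
    ((p : ℝ) ^ ((l + t) * t))⁻¹ * (constC p (k + l) * constC p k /
      (constC p (l + t) * constC p t * constC p (k - t)))
  else 0

theorem corankProb_succ_zero (hp : 3 ≤ p) (k l : ℕ) :
    corankProb p (k + 1) l 0 = (1 - ((p : ℝ) ^ (k + l + 1))⁻¹) * corankProb p k l 0 := by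
  have h1 := (constC_pos hp k).ne'
  have h2 := (constC_pos hp (k + 1)).ne'
  have h3 := (constC_pos hp l).ne'
  have h4 : constC p 0 = 1 := by simp [constC]
  have h5 : constC p (k + 1 + l) = constC p (k + l) * (1 - ((p : ℝ) ^ (k + l + 1))⁻¹) := by
    rw [← constC_succ, show k + 1 + l = k + l + 1 by ring]
  simp only [corankProb, Nat.zero_le, if_true, h4, add_zero, mul_zero, pow_zero, Nat.sub_zero, h5]
  field_simp

theorem corankProb_succ_succ (hp : 3 ≤ p) (k l t : ℕ) :
    corankProb p (k + 1) l (t + 1) =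
      ((p : ℝ) ^ (k + l + 1))⁻¹ * corankProb p k (l + 1) t +
        (1 - ((p : ℝ) ^ (k + l + 1))⁻¹) * corankProb p k l (t + 1) := by
  have hpos : (p : ℝ) ≠ 0 := by
    have : p ≠ 0 := by omega
    exact_mod_cast this
  rcases lt_trichotomy t k with h | rfl | h
  · obtain ⟨s, rfl⟩ := Nat.exists_eq_add_of_lt h
    simp only [corankProb]
    rw [if_pos (by omega), if_pos (by omega), if_pos (by omega),
      show t + s + 1 + 1 - (t + 1) = s + 1 by omega, show t + s + 1 - t = s + 1 by omega,
      show t + s + 1 - (t + 1) = s by omega, show t + s + 1 + 1 + l = t + s + 1 + l + 1 by ring,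
      show t + s + 1 + (l + 1) = t + s + 1 + l + 1 by ring, show l + 1 + t = l + (t + 1) by ring,
      constC_succ p (t + s + 1 + l), constC_succ p (t + s + 1), constC_succ p t, constC_succ p s]
    have a1 := (constC_pos hp (l + (t + 1))).ne'
    have a2 := (constC_pos hp t).ne'
    have a3 := (constC_pos hp s).ne'
    have a4 : (1 - ((p : ℝ) ^ (t + 1))⁻¹) ≠ 0 := fun h0 => by
      have := constC_succ p t
      rw [h0, mul_zero] at this
      exact (constC_pos hp (t + 1)).ne' this
    have a5 : (1 - ((p : ℝ) ^ (s + 1))⁻¹) ≠ 0 := fun h0 => by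
      have := constC_succ p s
      rw [h0, mul_zero] at this
      exact (constC_pos hp (s + 1)).ne' this
    simp only [← inv_pow] at a4 a5 ⊢
    set x := (p : ℝ)⁻¹
    field_simp
    ring
  · simp only [corankProb]
    rw [if_pos le_rfl, if_pos le_rfl, if_neg (by omega), mul_zero, add_zero, Nat.sub_self,
      Nat.sub_self, show t + 1 + l = t + (l + 1) by ring, show l + 1 + t = t + (l + 1) by ring,
      show l + (t + 1) = t + (l + 1) by ring]
    have a1 := (constC_pos hp (t + (l + 1))).ne'
    have a2 := (constC_pos hp t).ne'
    have a3 := (constC_pos hp (t + 1)).ne'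
    have a4 := (constC_pos hp 0).ne'
    field_simp
    ring
  · simp only [corankProb]
    rw [if_neg (by omega), if_neg (by omega), if_neg (by omega), mul_zero, mul_zero, add_zero]

end Constants

variable {p : ℕ} [hp : Fact p.Prime]

theorem three_le (hp2 : p ≠ 2) : 3 ≤ p := by
  have := hp.out.two_le
  omega

theorem mixedMu_succ_real (hp2 : p ≠ 2) {m k : ℕ} (hk : k ≤ m) {A : Set (Sch p)}
    (hA : MeasurableSet A) :
    (mixedMu p (m + 1) (k + 1)).real A =
      ((p : ℝ) ^ (m + 1))⁻¹ * (mixedMu p (m + 1) k).real A +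
        (1 - ((p : ℝ) ^ (m + 1))⁻¹) * (mixedMu p m k).real A := by
  have h1 : ((p : ℝ≥0∞) ^ (m + 1))⁻¹ ≤ 1 :=
    ENNReal.inv_le_one.2 (one_le_pow₀ (by exact_mod_cast hp.out.one_le))
  have h2 : ((p : ℝ≥0∞) ^ (m + 1))⁻¹ ≠ ∞ := ne_top_of_le_ne_top ENNReal.one_ne_top h1
  simp only [Measure.real, mixedMu_succ hp2 hk hA]
  rw [ENNReal.toReal_add (ENNReal.mul_ne_top h2 (measure_ne_top _ _))
      (ENNReal.mul_ne_top (ENNReal.sub_ne_top ENNReal.one_ne_top) (measure_ne_top _ _)),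
    ENNReal.toReal_mul, ENNReal.toReal_mul, ENNReal.toReal_sub_of_le h1 ENNReal.one_ne_top,
    ENNReal.toReal_inv, ENNReal.toReal_pow, ENNReal.toReal_natCast, ENNReal.toReal_one]

/-- The law of `[G_r]` is the mixture, over the corank `l + t` of the linear parts of the relations,
of the laws for relations in the Frattini subgroup of `F_{l + t}`. -/
theorem mixedMu_real_eq_sum (hp2 : p ≠ 2) (k l : ℕ) {A : Set (Sch p)} (hA : MeasurableSet A) :
    (mixedMu p (k + l) k).real A =
      ∑ t ∈ Finset.range (k + 1), corankProb p k l t * (mixedMu p (l + t) 0).real A := by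
  have h3 := three_le hp2
  induction k generalizing l with
  | zero =>
    have h1 := (constC_pos h3 0).ne'
    have h2 := (constC_pos h3 l).ne'
    have h4 : constC p 0 = 1 := by simp [constC]
    simp [corankProb, h4, h2]
  | succ k ih =>
    rw [show k + 1 + l = k + l + 1 by ring, mixedMu_succ_real hp2 (by omega) hA, ih l,
      show k + l + 1 = k + (l + 1) by ring, ih (l + 1), show k + (l + 1) = k + l + 1 by ring,
      Finset.sum_range_succ' _ (k + 1), corankProb_succ_zero h3]
    have h5 : ∑ t ∈ Finset.range (k + 1), corankProb p k l t * (mixedMu p (l + t) 0).real A =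
        ∑ t ∈ Finset.range (k + 1),
          corankProb p k l (t + 1) * (mixedMu p (l + (t + 1)) 0).real A +
        corankProb p k l 0 * (mixedMu p (l + 0) 0).real A := by
      rw [← Finset.sum_range_succ' (fun t => corankProb p k l t * (mixedMu p (l + t) 0).real A),
        Finset.sum_range_succ _ (k + 1)]
      have : corankProb p k l (k + 1) = 0 := if_neg (by omega)
      rw [this, zero_mul, add_zero]
    rw [h5, mul_add, Finset.mul_sum, Finset.mul_sum, ← add_assoc, ← Finset.sum_add_distrib,
      mul_assoc]
    congr 1
    refine Finset.sum_congr rfl fun t _ => ?_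
    rw [corankProb_succ_succ h3, show l + 1 + t = l + (t + 1) by ring]
    ring

/-! ### The limit -/

variable (p) in
/-- The limit for `n → ∞` of the probability that a random `n × n`-matrix has corank `j`. -/
noncomputable def limitProb (j : ℕ) : ℝ :=
  constCInf p / constC p j ^ 2 * ((p : ℝ) ^ (j ^ 2))⁻¹

theorem limitProb_nonneg (hp2 : p ≠ 2) (j : ℕ) : 0 ≤ limitProb p j := by
  have := half_le_constCInf (three_le hp2)
  have : 0 ≤ constCInf p := by linarith
  unfold limitProb
  positivity

theorem tendsto_corankProb (hp2 : p ≠ 2) (j : ℕ) :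
    Tendsto (fun n => corankProb p n 0 j) atTop (𝓝 (limitProb p j)) := by
  have h3 := three_le hp2
  have hC := tendsto_constC h3
  have hC0 : constCInf p ≠ 0 := by
    have := half_le_constCInf h3
    linarith
  have hj := (constC_pos h3 j).ne'
  have h1 : Tendsto (fun n => ((p : ℝ) ^ (j ^ 2))⁻¹ * (constC p n * constC p n /
      (constC p j * constC p j * constC p (n - j)))) atTop (𝓝 (((p : ℝ) ^ (j ^ 2))⁻¹ *
        (constCInf p * constCInf p / (constC p j * constC p j * constCInf p)))) :=
    ((hC.mul hC).div (tendsto_const_nhds.mul (hC.comp (tendsto_sub_atTop_nat j)))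
      (mul_ne_zero (mul_ne_zero hj hj) hC0)).const_mul _
  have h2 : limitProb p j = ((p : ℝ) ^ (j ^ 2))⁻¹ *
      (constCInf p * constCInf p / (constC p j * constC p j * constCInf p)) := by
    rw [limitProb]
    field_simp
  rw [h2]
  refine h1.congr' ?_
  filter_upwards [eventually_ge_atTop j] with n hn
  rw [corankProb, if_pos hn, zero_add, add_zero, pow_two]

theorem norm_corankProb_le (hp2 : p ≠ 2) (n j : ℕ) :
    ‖corankProb p n 0 j‖ ≤ 8 * ((p : ℝ)⁻¹) ^ j := by
  have h3 := three_le hp2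
  have hp1 : (1 : ℝ) ≤ p := by exact_mod_cast hp.out.one_le
  rw [corankProb]
  split_ifs with h
  · have hc := constC_pos h3
    have hn := constC_le_one h3 n
    have hj := half_le_constC h3 j
    have hnj := half_le_constC h3 (n - j)
    rw [zero_add, add_zero, Real.norm_of_nonneg (by
      have := hc n; have := hc j; have := hc (n - j); positivity), mul_comm]
    refine mul_le_mul ?_ ?_ (by positivity) (by norm_num)
    · rw [div_le_iff₀ (mul_pos (mul_pos (hc j) (hc j)) (hc _))]
      have h5 : constC p n * constC p n ≤ 1 := mul_le_one₀ hn (hc n).le hn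
      have h6 : 1 / 2 * (1 / 2) * (1 / 2) ≤ constC p j * constC p j * constC p (n - j) := by
        gcongr
      linarith
    · rw [inv_pow]
      exact inv_anti₀ (by positivity) (pow_le_pow_right₀ hp1 (Nat.le_mul_self j))
  · rw [norm_zero]
    positivity

variable (p) in
/-- The limit measure: the mixture of the laws for relations in the Frattini subgroup of `Fⱼ`, with
the weights `limitProb p j`. -/
noncomputable def muInf : Measure (Sch p) :=
  Measure.sum fun j => ENNReal.ofReal (limitProb p j) • mixedMu p j 0

theorem summable_limitProb (hp2 : p ≠ 2) : Summable (limitProb p) := by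
  have h3 : (3 : ℝ) ≤ p := by exact_mod_cast three_le hp2
  refine Summable.of_nonneg_of_le (limitProb_nonneg hp2) (fun j => ?_)
    ((summable_geometric_of_lt_one (r := (p : ℝ)⁻¹) (by positivity)
      (inv_lt_one_of_one_lt₀ (by linarith))).mul_left 8)
  refine le_of_tendsto' (tendsto_corankProb hp2 j) fun n => ?_
  exact (le_abs_self _).trans (norm_corankProb_le hp2 n j)

theorem muInf_apply (hp2 : p ≠ 2) {A : Set (Sch p)} (hA : MeasurableSet A) :
    muInf p A = ENNReal.ofReal (∑' j, limitProb p j * (mixedMu p j 0).real A) := by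
  have hnn := limitProb_nonneg hp2
  rw [muInf, Measure.sum_apply _ hA, ENNReal.ofReal_tsum_of_nonneg]
  · refine tsum_congr fun j => ?_
    rw [Measure.smul_apply, smul_eq_mul, ENNReal.ofReal_mul (hnn j), ofReal_measureReal]
  · exact fun j => mul_nonneg (hnn j) measureReal_nonneg
  · refine Summable.of_nonneg_of_le (fun j => mul_nonneg (hnn j) measureReal_nonneg) (fun j => ?_)
      (summable_limitProb hp2)
    exact mul_le_of_le_one_right (hnn j) measureReal_le_one

theorem tendsto_mu (hp2 : p ≠ 2) {A : Set (Sch p)} (hA : MeasurableSet A) :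
    Tendsto (fun n => mu p n A) atTop (𝓝 (muInf p A)) := by
  have h3 : (3 : ℝ) ≤ p := by exact_mod_cast three_le hp2
  rw [muInf_apply hp2 hA]
  have hmu : ∀ n, mu p n A =
      ENNReal.ofReal (∑' j, corankProb p n 0 j * (mixedMu p j 0).real A) := by
    intro n
    have h := mixedMu_real_eq_sum hp2 n 0 hA
    simp only [add_zero, zero_add] at h
    rw [tsum_eq_sum (s := Finset.range (n + 1)), ← h, ofReal_measureReal, mixedMu_self]
    intro j hj
    rw [corankProb, if_neg (by simpa using hj), zero_mul]
  simp only [hmu]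
  refine ENNReal.tendsto_ofReal ?_
  refine tendsto_tsum_of_dominated_convergence (bound := fun j => 8 * ((p : ℝ)⁻¹) ^ j) ?_ ?_ ?_
  · exact (summable_geometric_of_lt_one (by positivity)
      (inv_lt_one_of_one_lt₀ (by linarith))).mul_left 8
  · exact fun j => (tendsto_corankProb hp2 j).mul_const _
  · refine Eventually.of_forall fun n j => ?_
    rw [norm_mul, Real.norm_of_nonneg measureReal_nonneg]
    exact (mul_le_of_le_one_right (norm_nonneg _) measureReal_le_one).trans
      (norm_corankProb_le hp2 n j)

theorem isMuInf_muInf (hp2 : p ≠ 2) : IsMuInf p (muInf p) := by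
  refine ⟨⟨?_⟩, fun A hA => tendsto_mu hp2 hA⟩
  refine tendsto_nhds_unique (tendsto_mu hp2 MeasurableSet.univ) ?_
  refine tendsto_const_nhds.congr fun n => ?_
  rw [← mixedMu_self, measure_univ]

theorem eq_muInf_of_isMuInf (hp2 : p ≠ 2) {μ : Measure (Sch p)} (h : IsMuInf p μ) : μ = muInf p :=
  Measure.ext fun A hA => tendsto_nhds_unique (h.2 A hA) (tendsto_mu hp2 hA)

theorem muInf_schGens (hp2 : p ≠ 2) (n : ℕ) :
    muInf p (schGens p n) = ENNReal.ofReal (limitProb p n) := by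
  rw [muInf, Measure.sum_apply_of_countable, tsum_eq_single n]
  · rw [Measure.smul_apply, mixedMu_zero_schGens hp2, if_pos rfl, smul_eq_mul, mul_one]
  · intro j hj
    rw [Measure.smul_apply, mixedMu_zero_schGens hp2, if_neg hj, smul_zero]

end FreeProP

theorem mainTheorem12 (p : ℕ) [Fact p.Prime] (hp2 : p ≠ 2) :
    (∃! μ : Measure (Sch p), IsMuInf p μ) ∧
      ∀ μ : Measure (Sch p), IsMuInf p μ → ∀ n : ℕ,
        μ (schGens p n) =
          ENNReal.ofReal (constCInf p / constC p n ^ 2 * ((p : ℝ) ^ (n ^ 2))⁻¹) := by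
  refine ⟨⟨FreeProP.muInf p, FreeProP.isMuInf_muInf hp2,
    fun μ hμ => FreeProP.eq_muInf_of_isMuInf hp2 hμ⟩, fun μ hμ n => ?_⟩
  rw [FreeProP.eq_muInf_of_isMuInf hp2 hμ]
  exact FreeProP.muInf_schGens hp2 n
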